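/- Let $V$ be a real potential on $\mathbb Z$ (resp. on $\mathbb N=\{1,2,\dots\}$), and let $H$ be the self-adjoint operator on $\ell^2(\mathbb Z)$ (resp. $\ell^2(\mathbb N)$, with Dirichlet boundary condition $\psi(0)=0$) $$H\psi(n)=\psi(n-1)+\psi(n+1)+V(n)\psi(n).$$ Put $\psi(t,n)=(e^{-itH}\delta_1)(n)$, $$a(n,T)=\frac1T\int_0^\infty e^{-2t/T}|\psi(t,n)|^2\,dt,\qquad \langle|X|^p\rangle(T)=\sum_n|n|^p a(n,T).$$ For $z\in\mathbb C$ let $A(n,z)=\begin{pmatrix} z-V(n)&-1\\1&0\end{pmatrix}$, and define the transfer matrices by $T(n,m;z)=A(n,z)A(n-1,z)\cdots A(m+1,z)$ for $n>m$, $T(n,n;z)=I$, and $T(n,m;z)=T(m,n;z)^{-1}$ for $n<m$; $\|\cdot\|$ is the operator norm on $\mathbb C^2$ with the Euclidean norm. Let $K,C,\alpha>0$, and suppose that for every sufficiently large real $N$ there is a nonempty Borel set $A(N)\subset[-K,K]$ such that $$\|T(n,m;E)\|\le C N^\alpha\quad\text{for all }E\in A(N)\text{ and all integers } n,m\text{ with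 }|n|\le N,\ |m|\le N$$ (resp. with $1\le n\le N$, $1\le m\le N$ in the case of $\ell^2(\mathbb N)$). Let $N(T)=T^{1/(1+\alpha)}$ and $B(T)=\{E\in\mathbb R:\exists E'\in A(N(T)),\ |E-E'|\le 1/T\}$, and let $|B(T)|$ denote the Lebesgue measure of $B(T)$. Then there is a constant $\hat C>0$, depending only on $V,K,C,\alpha$, such that for all sufficiently large $T$ $$\sum_{|n|\ge N(T)/2}a(n,T)\ \ge\ \frac{\hat C}{T}\,|B(T)|\,N(T)^{1-2\alpha}.$$ Moreover, for every $p>0$ there is a constant $\hat C_p>0$, depending only on $V,K,C,\alpha,p$, such that for all sufficiently large $T$ $$\langle|X|^p\rangle(T)\ \ge\ \frac{\hat C_p}{T}\,|B(T)|\,N(T)^{p+1-2\alpha}.$$ -/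

import Mathlib

open Complex Set Filter Topology MeasureTheory
open scoped ENNReal

namespace DiscreteSchrodinger

/-! The unitary group generated by a self-adjoint operator is characterised in
`IsUnitaryGroupGeneratedBy`. The surrounding lemmas serve only to prove that such a group exists for
the discrete Schrödinger operator with an arbitrary, possibly unbounded, real potential. -/

section Abstract

theorem norm_const_of_inner_re_zero {E : Type*} [NormedAddCommGroup E] [InnerProductSpace ℂ E]
    {α v : ℝ → E} {s : Set ℝ} (hs : Convex ℝ s)
    (hα : ∀ t ∈ s, HasDerivWithinAt α (v t) s t)
    (hv : ∀ t ∈ s, (inner ℂ (α t) (v t)).re = 0) {a b : ℝ} (ha : a ∈ s) (hb : b ∈ s) :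
    ‖α a‖ = ‖α b‖ := by
  have key : ∀ t ∈ s, HasDerivWithinAt (fun t => inner ℂ (α t) (α t)) 0 s t := by
    intro t ht
    refine ((hα t ht).inner ℂ (hα t ht)).congr_deriv ?_
    rw [← inner_conj_symm (v t) (α t), Complex.add_conj, hv t ht]; simp
  have h := hs.norm_image_sub_le_of_norm_hasDerivWithin_le key (C := 0) (by simp) ha hb
  rw [zero_mul, norm_le_zero_iff, sub_eq_zero, inner_self_eq_norm_sq_to_K,
    inner_self_eq_norm_sq_to_K] at h
  have h' : ‖α b‖ ^ 2 = ‖α a‖ ^ 2 := by exact_mod_cast h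
  exact ((sq_eq_sq₀ (norm_nonneg _) (norm_nonneg _)).1 h').symm

variable {E : Type*} [NormedAddCommGroup E] [InnerProductSpace ℂ E]

theorem re_inner_neg_I_smul {A : E →L[ℂ] E} (hA : ∀ x y, inner ℂ (A x) y = inner ℂ x (A y))
    (x : E) : (inner ℂ x (-I • A x)).re = 0 := by
  have h : (starRingEnd ℂ) (inner ℂ x (A x)) = inner ℂ x (A x) := by
    rw [inner_conj_symm, hA]
  rw [inner_smul_right]
  have := Complex.conj_eq_iff_im.1 h
  simp [this]

theorem ode_unique {W : ℝ → E →L[ℂ] E}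
    (hsym : ∀ t x y, inner ℂ (W t x) y = inner ℂ x (W t y))
    {s : Set ℝ} (hs : Convex ℝ s) {α β : ℝ → E}
    (hα : ∀ t ∈ s, HasDerivWithinAt α (-I • W t (α t)) s t)
    (hβ : ∀ t ∈ s, HasDerivWithinAt β (-I • W t (β t)) s t)
    {a b : ℝ} (ha : a ∈ s) (hb : b ∈ s) (h : α a = β a) : α b = β b := by
  have h1 := norm_const_of_inner_re_zero hs (α := fun t => α t - β t)
    (v := fun t => -I • W t (α t - β t)) (fun t ht => by
      have := (hα t ht).fun_sub (hβ t ht)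
      rwa [← smul_sub, ← map_sub] at this)
    (fun t _ => re_inner_neg_I_smul (hsym t) _) hb ha
  rw [h, sub_self, norm_zero, norm_eq_zero] at h1
  exact sub_eq_zero.1 h1

/-- Radial retraction onto the closed ball of radius `R`, in the form used below. -/
theorem lipschitz_retraction (R : ℝ) (hR : 0 < R) (x y : E) :
    ‖((R / max R ‖x‖ : ℝ) : ℂ) • x - ((R / max R ‖y‖ : ℝ) : ℂ) • y‖ ≤ 2 * ‖x - y‖ := by
  set m := max R ‖x‖
  set m' := max R ‖y‖
  have hm : 0 < m := lt_max_of_lt_left hR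
  have hm' : 0 < m' := lt_max_of_lt_left hR
  have e : ((R / m : ℝ) : ℂ) • x - ((R / m' : ℝ) : ℂ) • y
      = ((R / m : ℝ) : ℂ) • (x - y) + ((R / m - R / m' : ℝ) : ℂ) • y := by
    rw [smul_sub]; push_cast; rw [sub_smul]; abel
  have h1 : R / m ≤ 1 := (div_le_one hm).2 (le_max_left _ _)
  have h2 : |R / m - R / m'| * ‖y‖ ≤ ‖x - y‖ := by
    have : R / m - R / m' = (R / m) * ((m' - m) / m') := by field_simp
    rw [this, abs_mul, abs_of_pos (div_pos hR hm), abs_div, abs_of_pos hm']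
    have h3 : |m' - m| ≤ ‖x - y‖ := by
      calc |m' - m| ≤ |‖y‖ - ‖x‖| := by
            simpa using abs_max_sub_max_le_max R ‖y‖ R ‖x‖
        _ ≤ ‖y - x‖ := abs_norm_sub_norm_le y x
        _ = ‖x - y‖ := norm_sub_rev _ _
    have h4 : ‖y‖ ≤ m' := le_max_right _ _
    calc R / m * (|m' - m| / m') * ‖y‖ = (R / m) * |m' - m| * (‖y‖ / m') := by ring
      _ ≤ 1 * ‖x - y‖ * 1 := by
        gcongr
        exact (div_le_one hm').2 h4
      _ = _ := by ring
  rw [e]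
  refine (norm_add_le _ _).trans ?_
  rw [norm_smul, norm_smul, Complex.norm_real, Complex.norm_real, Real.norm_eq_abs,
    Real.norm_eq_abs, abs_of_pos (div_pos hR hm)]
  nlinarith [norm_nonneg (x - y)]

theorem ode_exists_Icc [CompleteSpace E] {W : ℝ → E →L[ℂ] E}
    (hcont : ∀ x, Continuous fun t => W t x)
    (hsym : ∀ t x y, inner ℂ (W t x) y = inner ℂ x (W t y))
    (M : ℝ) (hM : ∀ t x, ‖W t x‖ ≤ M * ‖x‖) (x : E) (T : ℝ) (hT : 0 ≤ T) :
    ∃ α : ℝ → E, α 0 = x ∧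
      ∀ t ∈ Icc (-T) T, HasDerivWithinAt α (-I • W t (α t)) (Icc (-T) T) t := by
  set R : ℝ := ‖x‖ + 1
  have hR : 0 < R := by positivity
  set c : E → ℂ := fun y => ((R / max R ‖y‖ : ℝ) : ℂ)
  have hM' : ∀ t y, ‖W t y‖ ≤ |M| * ‖y‖ := fun t y =>
    (hM t y).trans (by gcongr; exact le_abs_self M)
  have hc : ∀ y : E, ‖c y • y‖ ≤ R := by
    intro y
    have hm : 0 < max R ‖y‖ := lt_max_of_lt_left hR
    simp only [c, norm_smul, Complex.norm_real, Real.norm_eq_abs]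
    rw [abs_of_pos (div_pos hR hm), div_mul_eq_mul_div, div_le_iff₀ hm]
    gcongr
    exact le_max_right _ _
  have h0 : (0 : ℝ) ∈ Icc (-T) T := ⟨by linarith, hT⟩
  have hPL : IsPicardLindelof (fun t y => -I • W t (c y • y)) (⟨0, h0⟩ : Icc (-T) T) x
      (Real.toNNReal (|M| * R * T)) 0 (Real.toNNReal (|M| * R)) (Real.toNNReal (|M| * 2)) := by
    refine ⟨fun t _ => LipschitzOnWith.of_dist_le_mul fun y _ z _ => ?_, fun y _ => ?_,
      fun t _ y _ => ?_, ?_⟩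
    · rw [dist_eq_norm, dist_eq_norm, ← smul_sub, ← map_sub, norm_smul, norm_neg, norm_I, one_mul,
        Real.coe_toNNReal _ (by positivity), mul_assoc]
      exact (hM' t _).trans (by gcongr; exact lipschitz_retraction R hR y z)
    · exact ((hcont _).const_smul _).continuousOn
    · rw [norm_smul, norm_neg, norm_I, one_mul, Real.coe_toNNReal _ (by positivity)]
      exact (hM' t _).trans (by gcongr; exact hc y)
    · rw [Real.coe_toNNReal _ (by positivity), Real.coe_toNNReal _ (by positivity)]
      simp
  obtain ⟨α, hα0, hα⟩ := hPL.exists_eq_forall_mem_Icc_hasDerivWithinAt₀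
  refine ⟨α, hα0, fun t ht => ?_⟩
  have hn : ‖α t‖ = ‖x‖ := by
    rw [← hα0]
    refine norm_const_of_inner_re_zero (convex_Icc _ _) hα (fun t _ => ?_) ht h0
    have : -I • W t (c (α t) • α t) = c (α t) • (-I • W t (α t)) := by
      rw [map_smul, smul_comm]
    rw [this, inner_smul_right, Complex.re_ofReal_mul, re_inner_neg_I_smul (hsym t), mul_zero]
  have hc1 : c (α t) = 1 := by
    simp only [c, hn]
    rw [max_eq_left (by simp [R]), div_self hR.ne', Complex.ofReal_one]
  have := hα t ht
  rwa [hc1, one_smul] at this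

theorem ode_exists [CompleteSpace E] {W : ℝ → E →L[ℂ] E}
    (hcont : ∀ x, Continuous fun t => W t x)
    (hsym : ∀ t x y, inner ℂ (W t x) y = inner ℂ x (W t y))
    (M : ℝ) (hM : ∀ t x, ‖W t x‖ ≤ M * ‖x‖) (x : E) :
    ∃ η : ℝ → E, η 0 = x ∧ ∀ t, HasDerivAt η (-I • W t (η t)) t := by
  have H : ∀ T : ℝ, ∃ α : ℝ → E, 0 ≤ T → α 0 = x ∧
      ∀ t ∈ Icc (-T) T, HasDerivWithinAt α (-I • W t (α t)) (Icc (-T) T) t := by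
    intro T
    by_cases hT : 0 ≤ T
    · obtain ⟨α, h⟩ := ode_exists_Icc hcont hsym M hM x T hT
      exact ⟨α, fun _ => h⟩
    · exact ⟨fun _ => x, fun h => absurd h hT⟩
  choose α hα using H
  have hglue : ∀ S T t : ℝ, |t| ≤ S → S ≤ T → α S t = α T t := by
    intro S T t hS hST
    have hS0 : 0 ≤ S := (abs_nonneg t).trans hS
    have hT0 : 0 ≤ T := hS0.trans hST
    have hsub : Icc (-S) S ⊆ Icc (-T) T := Icc_subset_Icc (by linarith) hST
    exact ode_unique hsym (convex_Icc (-S) S) (hα S hS0).2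
      (fun t ht => ((hα T hT0).2 t (hsub ht)).mono hsub)
      (a := 0) ⟨by linarith, hS0⟩ (abs_le.1 hS) ((hα S hS0).1.trans (hα T hT0).1.symm)
  refine ⟨fun t => α (|t| + 1) t, by simpa using (hα 1 zero_le_one).1, fun t => ?_⟩
  have hp : 0 ≤ |t| + 2 := by positivity
  have ht : t ∈ Ioo (-(|t| + 2)) (|t| + 2) := by
    constructor
    · linarith [neg_abs_le t]
    · linarith [le_abs_self t]
  have h1 : HasDerivAt (α (|t| + 2)) (-I • W t (α (|t| + 2) t)) t :=
    ((hα _ hp).2 t (Ioo_subset_Icc_self ht)).hasDerivAt (Icc_mem_nhds ht.1 ht.2)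
  rw [← hglue (|t| + 1) (|t| + 2) t (by linarith) (by linarith)] at h1
  refine h1.congr_of_eventuallyEq ?_
  have : ∀ᶠ s in 𝓝 t, |s| < |t| + 1 :=
    (continuous_abs.tendsto t).eventually (gt_mem_nhds (by linarith))
  filter_upwards [this] with s hs
  exact hglue _ _ s (by linarith) (by linarith)

/-- `U` is a strongly continuous one-parameter group of unitary operators with generator `-iH`
(`H` a possibly unbounded operator): `(U t x - x) / t` converges as `t → 0` exactly when `x` lies in
the domain of `H`, and then the limit is `-i H x`. That is, `U t = exp (-itH)`. -/
def IsUnitaryGroupGeneratedBy (H : E →ₗ.[ℂ] E) (U : ℝ → E ≃ₗᵢ[ℂ] E) : Prop :=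
  (∀ s t x, U (s + t) x = U s (U t x)) ∧
  (∀ x, Continuous fun t => U t x) ∧
  ∀ x y, (x, y) ∈ H.graph ↔
    Tendsto (fun t : ℝ => (t : ℂ)⁻¹ • (U t x - x)) (𝓝[≠] 0) (𝓝 (-I • y))

theorem continuous_apply_of_isometry {D : ℝ → E ≃ₗᵢ[ℂ] E} (hD : ∀ x, Continuous fun t => D t x)
    {a : ℝ → ℝ} {g : ℝ → E} (ha : Continuous a) (hg : Continuous g) :
    Continuous fun t => D (a t) (g t) :=
  (continuous_prod_of_continuous_lipschitzWith (fun p : E × ℝ => D p.2 p.1) 1 hD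
    (fun t => (D t).isometry.lipschitz)).comp (hg.prodMk ha)

theorem hasDerivAt_zero_iff (F : ℝ → E) (y : E) :
    HasDerivAt F y 0 ↔
      Tendsto (fun t : ℝ => (t : ℂ)⁻¹ • (F t - F 0)) (𝓝[≠] 0) (𝓝 y) := by
  rw [hasDerivAt_iff_tendsto_slope]
  refine tendsto_congr fun t => ?_
  rw [slope_def_module, sub_zero, ← Complex.ofReal_inv, Complex.coe_smul]

theorem exists_perturbed_group [CompleteSpace E] (D : ℝ → E ≃ₗᵢ[ℂ] E)
    (hgrp : ∀ s t x, D (s + t) x = D s (D t x)) (hcont : ∀ x, Continuous fun t => D t x)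
    (J : E →L[ℂ] E) (hJ : ∀ x y, inner ℂ (J x) y = inner ℂ x (J y)) :
    ∃ U : ℝ → E ≃ₗᵢ[ℂ] E, (∀ s t x, U (s + t) x = U s (U t x)) ∧
      (∀ x, Continuous fun t => U t x) ∧
      ∀ x y, Tendsto (fun t : ℝ => (t : ℂ)⁻¹ • (D t x - x)) (𝓝[≠] 0) (𝓝 y) ↔
        Tendsto (fun t : ℝ => (t : ℂ)⁻¹ • (U t x - x)) (𝓝[≠] 0) (𝓝 (y - I • J x)) := by
  have hD0 : ∀ x, D 0 x = x := fun x => by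
    have := hgrp 0 0 x
    rw [add_zero] at this
    exact ((D 0).injective this).symm
  have hDn : ∀ t x, D t (D (-t) x) = x := fun t x => by rw [← hgrp, add_neg_cancel, hD0]
  have hnD : ∀ t x, D (-t) (D t x) = x := fun t x => by rw [← hgrp, neg_add_cancel, hD0]
  set W : ℝ → E →L[ℂ] E := fun t =>
    ((D (-t)).toContinuousLinearEquiv : E →L[ℂ] E) ∘L J ∘L ((D t).toContinuousLinearEquiv : E →L[ℂ] E)
  have hW : ∀ t x, W t x = D (-t) (J (D t x)) := fun t x => rfl
  have hadj : ∀ t x y, inner ℂ (D (-t) x) y = inner ℂ x (D t y) := fun t x y => by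
    rw [← (D t).inner_map_map, hDn]
  have hadj' : ∀ t x y, inner ℂ (D t x) y = inner ℂ x (D (-t) y) := fun t x y => by
    rw [← (D (-t)).inner_map_map, hnD]
  have hsym : ∀ t x y, inner ℂ (W t x) y = inner ℂ x (W t y) := fun t x y => by
    rw [hW, hW, hadj, hJ, hadj']
  have hWc : ∀ g : ℝ → E, Continuous g → Continuous fun t => W t (g t) := fun g hg =>
    continuous_apply_of_isometry hcont continuous_neg
      (J.continuous.comp (continuous_apply_of_isometry hcont continuous_id hg))
  have hM : ∀ t x, ‖W t x‖ ≤ ‖J‖ * ‖x‖ := fun t x => by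
    rw [hW, LinearIsometryEquiv.norm_map]
    exact (J.le_opNorm _).trans (by rw [LinearIsometryEquiv.norm_map])
  choose η h0 hη using ode_exists (fun x => hWc _ continuous_const) hsym ‖J‖ hM
  have huniq : ∀ x (α : ℝ → E), α 0 = x → (∀ t, HasDerivAt α (-I • W t (α t)) t) → α = η x := by
    intro x α hα0 hα
    ext1 t
    exact ode_unique hsym convex_univ (fun t _ => (hα t).hasDerivWithinAt)
      (fun t _ => (hη x t).hasDerivWithinAt) (mem_univ 0) (mem_univ t) (hα0.trans (h0 x).symm)
  have hadd : ∀ x y t, η (x + y) t = η x t + η y t := fun x y t => by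
    refine (congrFun (huniq (x + y) (fun t => η x t + η y t) (by simp [h0]) fun t => ?_) t).symm
    rw [map_add, smul_add]
    exact (hη x t).add (hη y t)
  have hsmul : ∀ (c : ℂ) x t, η (c • x) t = c • η x t := fun c x t => by
    refine (congrFun (huniq (c • x) (fun t => c • η x t) (by simp [h0]) fun t => ?_) t).symm
    rw [map_smul, smul_comm]
    exact (hη x t).const_smul c
  have hnorm : ∀ x t, ‖η x t‖ = ‖x‖ := fun x t => by
    have := (norm_const_of_inner_re_zero convex_univ (fun t _ => (hη x t).hasDerivWithinAt)
      (fun t _ => re_inner_neg_I_smul (hsym t) _) (mem_univ t) (mem_univ 0))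
    rwa [h0] at this
  have hηc : ∀ x, Continuous (η x) := fun x =>
    continuous_iff_continuousAt.2 fun t => (hη x t).continuousAt
  have hstep : ∀ s t x, D (t + s) (η x (t + s)) = D t (η (D s (η x s)) t) := by
    intro s t x
    rw [hgrp]
    congr 1
    refine congrFun (huniq _ (fun t => D s (η x (t + s))) (by simp) fun t => ?_) t
    have h1 : HasDerivAt (fun t => η x (t + s)) (-I • W (t + s) (η x (t + s))) t :=
      (hη x (t + s)).comp_add_const t s
    have h2 := (((D s).toContinuousLinearEquiv : E →L[ℂ] E).restrictScalars ℝ).hasFDerivAt.comp_hasDerivAt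
      t h1
    refine h2.congr_deriv ?_
    change D s (-I • W (t + s) (η x (t + s))) = _
    rw [map_smul, hW, hW, ← hgrp, ← hgrp, show s + -(t + s) = -t by ring]
  let u : ℝ → E →ₗᵢ[ℂ] E := fun t =>
    { toFun := fun x => D t (η x t)
      map_add' := fun x y => by rw [hadd, map_add]
      map_smul' := fun c x => by rw [hsmul, map_smul]; rfl
      norm_map' := fun x => by
        change ‖D t (η x t)‖ = ‖x‖
        rw [LinearIsometryEquiv.norm_map, hnorm] }
  have hu : ∀ t x, u t x = D t (η x t) := fun _ _ => rfl
  have hug : ∀ s t x, u (s + t) x = u s (u t x) := fun s t x => hstep t s x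
  have hu0 : ∀ x, u 0 x = x := fun x => by rw [hu, h0, hD0]
  let U : ℝ → E ≃ₗᵢ[ℂ] E := fun t =>
    LinearIsometryEquiv.ofSurjective (u t) fun x => ⟨u (-t) x, by
      rw [← hug, add_neg_cancel, hu0]⟩
  refine ⟨U, hug, fun x => continuous_apply_of_isometry hcont continuous_id (hηc x), fun x y => ?_⟩
  have hd : HasDerivAt (fun t => D t (η x t - x)) (-I • J x) 0 := by
    rw [hasDerivAt_iff_tendsto_slope]
    have hs : Tendsto (fun t : ℝ => slope (η x) 0 t) (𝓝[≠] 0) (𝓝 (-I • J x)) := by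
      have := hasDerivAt_iff_tendsto_slope.1 (hη x 0)
      rwa [h0, hW, hD0, neg_zero, hD0] at this
    have hc : Continuous fun p : E × ℝ => D p.2 p.1 :=
      continuous_prod_of_continuous_lipschitzWith (fun p : E × ℝ => D p.2 p.1) 1 hcont
        (fun t => (D t).isometry.lipschitz)
    have := (hc.tendsto (-I • J x, 0)).comp
      (hs.prodMk_nhds (tendsto_id.mono_left nhdsWithin_le_nhds))
    simp only [hD0] at this
    refine this.congr fun t => ?_
    simp only [Function.comp, slope, vsub_eq_sub, h0, sub_self, map_zero, sub_zero, id]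
    exact ((D t).toLinearEquiv.toLinearMap.restrictScalars ℝ).map_smul _ _
  have hU : (fun t => U t x) = fun t => D t x + D t (η x t - x) := by
    ext1 t
    change D t (η x t) = _
    rw [← map_add, add_sub_cancel]
  have e1 := hasDerivAt_zero_iff (fun t => D t x) y
  have e2 := hasDerivAt_zero_iff (fun t => U t x) (y - I • J x)
  have hU0 : U 0 x = x := hu0 x
  simp only [hD0, hU0] at e1 e2
  rw [← e1, ← e2]
  constructor
  · intro h
    rw [hU, sub_eq_add_neg, ← neg_smul]
    exact h.add hd
  · intro h
    have := h.sub hd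
    rw [neg_smul, sub_neg_eq_add, sub_add_cancel] at this
    refine this.congr_of_eventuallyEq (Eventually.of_forall fun t => ?_)
    simp [hU]

end Abstract

section Diagonal

variable {ι : Type*}

theorem summable_norm_sq (f : lp (fun _ : ι => ℂ) 2) : Summable fun n => ‖f n‖ ^ 2 := by
  simpa using (lp.memℓp f).summable (by simp)

theorem hasSum_norm_sq (f : lp (fun _ : ι => ℂ) 2) : HasSum (fun n => ‖f n‖ ^ 2) (‖f‖ ^ 2) := by
  simpa using lp.hasSum_norm (p := 2) (by simp) f

theorem memℓp_two {u : ι → ℂ} (h : Summable fun n => ‖u n‖ ^ 2) : Memℓp u 2 :=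
  memℓp_gen (by simpa using h)

theorem norm_phase (s : ℝ) : ‖cexp (-I * s)‖ = 1 := by
  rw [show -I * (s : ℂ) = ((-s : ℝ) : ℂ) * I by push_cast; ring]
  exact Complex.norm_exp_ofReal_mul_I _

/-- The multiplication operator `f n ↦ exp (-i t V n) f n`. -/
noncomputable def phase (V : ι → ℝ) (t : ℝ) (f : lp (fun _ : ι => ℂ) 2) :
    lp (fun _ : ι => ℂ) 2 :=
  ⟨fun n => cexp (-I * ((t * V n : ℝ) : ℂ)) * f n, memℓp_two (by
    simp only [norm_mul, norm_phase, one_mul]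
    exact summable_norm_sq f)⟩

theorem phase_apply (V : ι → ℝ) (t : ℝ) (f : lp (fun _ : ι => ℂ) 2) (n : ι) :
    phase V t f n = cexp (-I * ((t * V n : ℝ) : ℂ)) * f n := rfl

theorem phase_add (V : ι → ℝ) (s t : ℝ) (f : lp (fun _ : ι => ℂ) 2) :
    phase V (s + t) f = phase V s (phase V t f) := by
  ext n
  rw [phase_apply, phase_apply, phase_apply, ← mul_assoc, ← Complex.exp_add]
  congr 2
  push_cast; ring

theorem phase_zero (V : ι → ℝ) (f : lp (fun _ : ι => ℂ) 2) : phase V 0 f = f := by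
  ext n
  simp [phase_apply]

/-- The unitary group of the multiplication operator by `V`. -/
noncomputable def phaseGroup (V : ι → ℝ) (t : ℝ) :
    lp (fun _ : ι => ℂ) 2 ≃ₗᵢ[ℂ] lp (fun _ : ι => ℂ) 2 where
  toFun := phase V t
  invFun := phase V (-t)
  left_inv f := by rw [← phase_add, neg_add_cancel, phase_zero]
  right_inv f := by rw [← phase_add, add_neg_cancel, phase_zero]
  map_add' f g := by
    ext n
    simp only [phase_apply, lp.coeFn_add, Pi.add_apply]
    ring
  map_smul' c f := by
    ext n
    simp only [phase_apply, lp.coeFn_smul, Pi.smul_apply, smul_eq_mul, RingHom.id_apply]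
    ring
  norm_map' f := by
    have h1 := hasSum_norm_sq f
    have h2 := hasSum_norm_sq (phase V t f)
    simp only [phase_apply, norm_mul, norm_phase, one_mul] at h2
    exact (sq_eq_sq₀ (norm_nonneg _) (norm_nonneg _)).1 (h2.unique h1)

theorem phaseGroup_apply (V : ι → ℝ) (t : ℝ) (f : lp (fun _ : ι => ℂ) 2) (n : ι) :
    phaseGroup V t f n = cexp (-I * ((t * V n : ℝ) : ℂ)) * f n :=
  phase_apply V t f n

theorem tendsto_of_tsum {l : Filter ℝ} {F : ℝ → lp (fun _ : ι => ℂ) 2}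
    {G : lp (fun _ : ι => ℂ) 2} {b : ι → ℝ} (hb : Summable b)
    (hlim : ∀ n, Tendsto (fun t => F t n) l (𝓝 (G n)))
    (hbound : ∀ᶠ t in l, ∀ n, ‖F t n - G n‖ ^ 2 ≤ b n) : Tendsto F l (𝓝 G) := by
  rw [tendsto_iff_norm_sub_tendsto_zero]
  have h : Tendsto (fun t => ∑' n, ‖F t n - G n‖ ^ 2) l (𝓝 (∑' _ : ι, (0 : ℝ))) := by
    refine tendsto_tsum_of_dominated_convergence hb (fun n => ?_) ?_
    · have := (tendsto_iff_norm_sub_tendsto_zero.1 (hlim n)).pow 2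
      simpa using this
    · filter_upwards [hbound] with t ht n
      simpa using ht n
  rw [tsum_zero] at h
  have h2 : ∀ t, ∑' n, ‖F t n - G n‖ ^ 2 = ‖F t - G‖ ^ 2 := fun t => by
    have := (hasSum_norm_sq (F t - G)).tsum_eq
    simpa using this
  simp only [h2] at h
  have := h.sqrt
  simpa using this

theorem continuous_phaseGroup (V : ι → ℝ) (f : lp (fun _ : ι => ℂ) 2) :
    Continuous fun t => phaseGroup V t f := by
  refine continuous_iff_continuousAt.2 fun t => ?_
  refine tendsto_of_tsum ((summable_norm_sq f).mul_left 4) (fun n => ?_)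
    (Eventually.of_forall fun s n => ?_)
  · simp only [phaseGroup_apply]
    have : Continuous fun t : ℝ => cexp (-I * ((t * V n : ℝ) : ℂ)) * f n := by fun_prop
    exact this.tendsto t
  · have h : ‖phaseGroup V s f n - phaseGroup V t f n‖ ≤ 2 * ‖f n‖ := by
      refine (norm_sub_le _ _).trans ?_
      rw [phaseGroup_apply, phaseGroup_apply, norm_mul, norm_mul, norm_phase, norm_phase]
      linarith
    calc _ ≤ (2 * ‖f n‖) ^ 2 := by gcongr
      _ = _ := by ring

theorem norm_exp_sub_one_le (s : ℝ) : ‖cexp (-I * s) - 1‖ ≤ |s| := by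
  have := Real.norm_exp_I_mul_ofReal_sub_one_le (x := -s)
  rw [show -I * (s : ℂ) = I * ((-s : ℝ) : ℂ) by push_cast; ring]
  simpa using this

theorem hasDerivAt_phase (V : ℝ) (z : ℂ) :
    HasDerivAt (fun t : ℝ => cexp (-I * ((t * V : ℝ) : ℂ)) * z) (-I * (V * z)) 0 := by
  have h1 : HasDerivAt (fun t : ℝ => -I * ((t * V : ℝ) : ℂ)) (-I * V) 0 := by
    have := ((hasDerivAt_id (0 : ℝ)).mul_const V).ofReal_comp.const_mul (-I)
    simpa using this
  have := h1.cexp.mul_const z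
  refine this.congr_deriv ?_
  simp; ring

theorem tendsto_phaseGroup_iff (V : ι → ℝ) (f g : lp (fun _ : ι => ℂ) 2) :
    Tendsto (fun t : ℝ => (t : ℂ)⁻¹ • (phaseGroup V t f - f)) (𝓝[≠] 0) (𝓝 (-I • g)) ↔
      ∀ n, g n = V n * f n := by
  have hc : ∀ (t : ℝ) n, ((t : ℂ)⁻¹ • (phaseGroup V t f - f)) n
      = (t : ℂ)⁻¹ • (cexp (-I * ((t * V n : ℝ) : ℂ)) * f n - f n) := fun t n => rfl
  have hG : ∀ n, (-I • g) n = -I * g n := fun n => rfl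
  have hl : ∀ n, Tendsto (fun t : ℝ => ((t : ℂ)⁻¹ • (phaseGroup V t f - f)) n) (𝓝[≠] 0)
      (𝓝 (-I * (V n * f n))) := fun n => by
    have := (hasDerivAt_zero_iff _ _).1 (hasDerivAt_phase (V n) (f n))
    simpa [hc] using this
  constructor
  · intro h n
    have h1 := ((lp.evalCLM ℂ (fun _ : ι => ℂ) 2 n).continuous.tendsto _).comp h
    have := tendsto_nhds_unique h1 (hl n)
    change -I * g n = _ at this
    exact mul_left_cancel₀ (neg_ne_zero.2 I_ne_zero) this
  · intro h
    refine tendsto_of_tsum ((summable_norm_sq g).mul_left 4) (fun n => ?_)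
      (Eventually.of_forall fun t n => ?_)
    · rw [hG, h]
      exact hl n
    · have h1 : ‖((t : ℂ)⁻¹ • (phaseGroup V t f - f)) n‖ ≤ ‖g n‖ := by
        rw [hc, h, ← sub_one_mul, norm_smul, norm_mul, norm_mul, norm_inv,
          Complex.norm_real, Real.norm_eq_abs, Complex.norm_real, Real.norm_eq_abs]
        rcases eq_or_ne t 0 with rfl | ht
        · simp; positivity
        · have h2 := norm_exp_sub_one_le (t * V n)
          rw [abs_mul] at h2
          rw [inv_mul_le_iff₀ (abs_pos.2 ht), ← mul_assoc]
          gcongr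
      have h2 : ‖(-I • g) n‖ = ‖g n‖ := by rw [hG]; simp
      calc _ ≤ (‖g n‖ + ‖g n‖) ^ 2 := by
            gcongr
            exact (norm_sub_le _ _).trans (by rw [h2]; gcongr)
        _ = _ := by ring

end Diagonal

section Operator

/-- The one-dimensional lattices under consideration. -/
inductive LatticeKind
  | wholeLine
  | halfLine

/-- The sites of the lattice, as a set of integers: all of `ℤ`, or `{1, 2, 3, …}`. -/
def LatticeKind.sites : LatticeKind → Set ℤ
  | .wholeLine => Set.univ
  | .halfLine => Set.Ici 1

theorem LatticeKind.one_mem_sites (Λ : LatticeKind) : (1 : ℤ) ∈ Λ.sites := by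
  cases Λ <;> simp [LatticeKind.sites]

/-- The Hilbert space `ℓ²(ℤ)` or `ℓ²(ℕ)`. -/
abbrev LatticeKind.Hilbert (Λ : LatticeKind) : Type := lp (fun _ : Λ.sites => ℂ) 2

variable {Λ : LatticeKind}

/-- Extension of a function on the sites to `ℤ` by zero. -/
noncomputable def extendZero (u : Λ.sites → ℂ) : ℤ → ℂ :=
  Function.extend Subtype.val u 0

/-- The formal difference expression `(H u)(n) = u (n-1) + u (n+1) + V n u n`.
On the half-line `u 0` is read as `0` (Dirichlet boundary condition). -/
noncomputable def formalOperator (V : ℤ → ℝ) (u : Λ.sites → ℂ) (n : Λ.sites) : ℂ :=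
  extendZero u (n - 1) + extendZero u (n + 1) + V n * u n

theorem extendZero_apply (u : Λ.sites → ℂ) (n : Λ.sites) : extendZero u n = u n :=
  Subtype.val_injective.extend_apply u 0 n

theorem extendZero_add (u v : Λ.sites → ℂ) : extendZero (u + v) = extendZero u + extendZero v := by
  have := Function.extend_add (Subtype.val : Λ.sites → ℤ) u v 0 0
  rwa [add_zero] at this

theorem extendZero_smul (c : ℂ) (u : Λ.sites → ℂ) : extendZero (c • u) = c • extendZero u := by
  have := Function.extend_smul c (Subtype.val : Λ.sites → ℤ) u 0
  rwa [smul_zero] at this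

theorem formalOperator_add (V : ℤ → ℝ) (u v : Λ.sites → ℂ) :
    formalOperator V (u + v) = formalOperator V u + formalOperator V v := by
  ext n
  simp only [formalOperator, extendZero_add, Pi.add_apply]
  ring

theorem formalOperator_smul (V : ℤ → ℝ) (c : ℂ) (u : Λ.sites → ℂ) :
    formalOperator V (c • u) = c • formalOperator V u := by
  ext n
  simp only [formalOperator, extendZero_smul, Pi.smul_apply, smul_eq_mul]
  ring

/-- The discrete Schrödinger operator with potential `V` in `ℓ²`, on its natural (maximal) domain
of all `u ∈ ℓ²` with `H u ∈ ℓ²`. The potential may be unbounded; for bounded `V` the domain is the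
whole space. -/
noncomputable def schrodinger (Λ : LatticeKind) (V : ℤ → ℝ) : Λ.Hilbert →ₗ.[ℂ] Λ.Hilbert where
  domain :=
    { carrier := {u | Memℓp (formalOperator V u) 2}
      add_mem' := fun {u v} hu hv => by
        change Memℓp (formalOperator V (u + v : Λ.Hilbert)) 2
        rw [lp.coeFn_add, formalOperator_add]
        exact hu.add hv
      zero_mem' := by
        change Memℓp (formalOperator V (0 : Λ.Hilbert)) 2
        have := formalOperator_smul V 0 ((0 : Λ.Hilbert) : Λ.sites → ℂ)
        rw [zero_smul, zero_smul] at this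
        rw [lp.coeFn_zero, this]
        exact zero_memℓp
      smul_mem' := fun c u hu => by
        change Memℓp (formalOperator V (c • u : Λ.Hilbert)) 2
        rw [lp.coeFn_smul, formalOperator_smul]
        exact hu.const_smul c }
  toFun :=
    { toFun := fun u => ⟨formalOperator V (u : Λ.Hilbert), u.2⟩
      map_add' := fun u v => by
        ext n
        exact congrFun (formalOperator_add V (u : Λ.Hilbert) (v : Λ.Hilbert)) n
      map_smul' := fun c u => by
        ext n
        exact congrFun (formalOperator_smul V c (u : Λ.Hilbert)) n }

theorem mem_graph_schrodinger (V : ℤ → ℝ) (x y : Λ.Hilbert) :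
    (x, y) ∈ (schrodinger Λ V).graph ↔ ∀ n, y n = formalOperator V x n := by
  rw [LinearPMap.mem_graph_iff]
  constructor
  · rintro ⟨z, rfl, rfl⟩ n
    rfl
  · intro h
    have hy : formalOperator V x = y := funext fun n => (h n).symm
    refine ⟨⟨x, ?_⟩, rfl, ?_⟩
    · change Memℓp (formalOperator V x) 2
      rw [hy]
      exact lp.memℓp y
    · ext n
      exact (h n).symm

theorem hasSum_extendZero (f : Λ.Hilbert) :
    HasSum (fun k => ‖extendZero f k‖ ^ 2) (‖f‖ ^ 2) := by
  refine ((Subtype.val_injective (p := (· ∈ Λ.sites))).hasSum_iff (fun k hk => ?_)).1 ?_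
  · rw [extendZero, Function.extend_apply' _ _ _ hk]; simp
  · simpa [Function.comp_def, extendZero_apply] using hasSum_norm_sq f

theorem summable_shift (c : ℤ) (f : Λ.Hilbert) :
    Summable fun n : Λ.sites => ‖extendZero f (n + c)‖ ^ 2 :=
  (hasSum_extendZero f).summable.comp_injective
    (i := fun n : Λ.sites => (n : ℤ) + c) fun _ _ h => Subtype.ext (add_right_cancel h)

/-- Translation by `c`. -/
noncomputable def shift (c : ℤ) : Λ.Hilbert →L[ℂ] Λ.Hilbert :=
  LinearMap.mkContinuous
    { toFun := fun f => ⟨fun n => extendZero f (n + c), memℓp_two (summable_shift c f)⟩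
      map_add' := fun f g => by
        ext n
        exact congrFun (extendZero_add (f : Λ.sites → ℂ) g) (n + c)
      map_smul' := fun a f => by
        ext n
        exact congrFun (extendZero_smul a (f : Λ.sites → ℂ)) (n + c) } 1 fun f => by
    rw [one_mul]
    refine (sq_le_sq₀ (norm_nonneg _) (norm_nonneg _)).1 ?_
    have h1 := hasSum_norm_sq (⟨fun n => extendZero f (n + c), memℓp_two (summable_shift c f)⟩ :
      Λ.Hilbert)
    have h2 := hasSum_extendZero f
    exact hasSum_le_inj (fun n : Λ.sites => (n : ℤ) + c)
      (fun _ _ h => Subtype.ext (add_right_cancel h)) (fun k _ => sq_nonneg _)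
      (fun n => le_refl (‖extendZero f (n + c)‖ ^ 2)) h1 h2

theorem shift_apply (c : ℤ) (f : Λ.Hilbert) (n : Λ.sites) : shift c f n = extendZero f (n + c) :=
  rfl

theorem inner_eq_tsum_extendZero (f : Λ.Hilbert) (u : ℤ → ℂ) :
    ∑' n : Λ.sites, inner ℂ (f n) (u n) = ∑' k : ℤ, inner ℂ (extendZero f k) (u k) := by
  rw [← (Subtype.val_injective (p := (· ∈ Λ.sites))).tsum_eq (f := fun k : ℤ => inner ℂ (extendZero f k) (u k))]
  · simp only [extendZero_apply]
  · intro k hk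
    by_contra h
    refine hk ?_
    simp only [extendZero, Function.extend_apply' _ _ _ h]
    simp

theorem inner_shift (c : ℤ) (f g : Λ.Hilbert) :
    inner ℂ (shift c f) g = inner ℂ f (shift (-c) g) := by
  have h1 : inner ℂ f (shift (-c) g)
      = ∑' k : ℤ, inner ℂ (extendZero f k) (extendZero g (k + -c)) := by
    rw [lp.inner_eq_tsum]
    exact inner_eq_tsum_extendZero f fun k => extendZero g (k + -c)
  have h2 : inner ℂ g (shift c f)
      = ∑' k : ℤ, inner ℂ (extendZero g k) (extendZero f (k + c)) := by
    rw [lp.inner_eq_tsum]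
    exact inner_eq_tsum_extendZero g fun k => extendZero f (k + c)
  rw [← inner_conj_symm, h2, h1, Complex.conj_tsum,
    ← (Equiv.addRight c).tsum_eq fun k => inner ℂ (extendZero f k) (extendZero g (k + -c))]
  simp only [inner_conj_symm, Equiv.coe_addRight, add_neg_cancel_right]

/-- Existence of the unitary group generated by `H`. -/
theorem exists_unitaryGroup (Λ : LatticeKind) (V : ℤ → ℝ) :
    ∃ U, IsUnitaryGroupGeneratedBy (schrodinger Λ V) U := by
  obtain ⟨U, h1, h2, h3⟩ := exists_perturbed_group (phaseGroup fun n : Λ.sites => V n)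
    (fun s t f => phase_add _ s t f) (continuous_phaseGroup _)
    (shift (-1) + shift 1 : Λ.Hilbert →L[ℂ] Λ.Hilbert) (fun f g => by
      simp only [add_apply, inner_add_left, inner_add_right, inner_shift,
        neg_neg]
      ring)
  refine ⟨U, h1, h2, fun x y => ?_⟩
  set J : Λ.Hilbert →L[ℂ] Λ.Hilbert := shift (-1) + shift 1
  have e : -I • y = -I • (y - J x) - I • J x := by
    rw [smul_sub, neg_smul, neg_smul]; abel
  rw [e, ← h3, tendsto_phaseGroup_iff, mem_graph_schrodinger]
  refine forall_congr' fun n => ?_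
  have : (y - J x) n = y n - (extendZero x (n - 1) + extendZero x (n + 1)) := rfl
  rw [this, sub_eq_iff_eq_add, formalOperator, add_comm]

/-- The unitary group `U t = exp (-itH)` generated by `H`. -/
noncomputable def unitaryGroup (Λ : LatticeKind) (V : ℤ → ℝ) : ℝ → Λ.Hilbert ≃ₗᵢ[ℂ] Λ.Hilbert :=
  (exists_unitaryGroup Λ V).choose

/-- The initial state `δ_1`. -/
noncomputable def deltaOne (Λ : LatticeKind) : Λ.Hilbert :=
  lp.single 2 ⟨1, Λ.one_mem_sites⟩ 1

/-- `ψ(t,n)`, the value at site `n` of `exp (-itH) δ_1`. -/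
noncomputable def amplitude (Λ : LatticeKind) (V : ℤ → ℝ) (t : ℝ) (n : Λ.sites) : ℂ :=
  unitaryGroup Λ V t (deltaOne Λ) n

/-- `a(n,T) = (1/T) ∫_0^∞ exp (-2t/T) |ψ(t,n)|² dt`. -/
noncomputable def timeAverage (Λ : LatticeKind) (V : ℤ → ℝ) (n : Λ.sites) (T : ℝ) : ℝ :=
  1 / T * ∫ t in Ioi (0 : ℝ), Real.exp (-2 * t / T) * ‖amplitude Λ V t n‖ ^ 2

/-- The time-averaged outside probability: the sum of `a(n,T)` over the sites with `|n| ≥ R`. -/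
noncomputable def outsideProbability (Λ : LatticeKind) (V : ℤ → ℝ) (R T : ℝ) : ℝ≥0∞ :=
  ∑' n : {n : Λ.sites // R ≤ |((n : ℤ) : ℝ)|}, ENNReal.ofReal (timeAverage Λ V n T)

/-- The time-averaged moment `∑ |n|^p a(n,T)` of the position operator. -/
noncomputable def moment (Λ : LatticeKind) (V : ℤ → ℝ) (p T : ℝ) : ℝ≥0∞ :=
  ∑' n : Λ.sites, ENNReal.ofReal (|((n : ℤ) : ℝ)| ^ p * timeAverage Λ V n T)

end Operator

section Transfer

/-- The one-step transfer matrix `A(n,z)`. -/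
noncomputable def stepMatrix (V : ℤ → ℝ) (n : ℤ) (z : ℂ) : Matrix (Fin 2) (Fin 2) ℂ :=
  !![z - V n, -1; 1, 0]

/-- The product `A(m+k,z) ⋯ A(m+1,z)`. -/
noncomputable def stepProduct (V : ℤ → ℝ) (m : ℤ) (z : ℂ) : ℕ → Matrix (Fin 2) (Fin 2) ℂ
  | 0 => 1
  | k + 1 => stepMatrix V (m + (k + 1 : ℕ)) z * stepProduct V m z k

/-- The transfer matrix `T(n,m;z)`: the product `A(n,z) ⋯ A(m+1,z)` for `n > m`, the identity for
`n = m`, and the inverse of `T(m,n;z)` for `n < m`. -/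
noncomputable def transferMatrix (V : ℤ → ℝ) (n m : ℤ) (z : ℂ) : Matrix (Fin 2) (Fin 2) ℂ :=
  if m ≤ n then stepProduct V m z (n - m).toNat else (stepProduct V n z (m - n).toNat)⁻¹

/-- The operator norm of a `2 × 2` matrix acting on `ℂ²` with its Euclidean norm. -/
noncomputable def opNorm (M : Matrix (Fin 2) (Fin 2) ℂ) : ℝ :=
  ‖Matrix.toEuclideanCLM (𝕜 := ℂ) M‖

/-- For all large `N`, `A N` is a nonempty Borel subset of `[-K,K]`, and
`‖T(n,m;E)‖ ≤ C N^α` for all `E ∈ A N` and all sites `n`, `m` with `|n| ≤ N`, `|m| ≤ N`. -/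
def PowerLawBound (Λ : LatticeKind) (V : ℤ → ℝ) (K C α : ℝ) (A : ℝ → Set ℝ) : Prop :=
  ∀ᶠ N : ℝ in atTop, (A N).Nonempty ∧ MeasurableSet (A N) ∧ A N ⊆ Icc (-K) K ∧
    ∀ E ∈ A N, ∀ n ∈ Λ.sites, ∀ m ∈ Λ.sites, |(n : ℝ)| ≤ N → |(m : ℝ)| ≤ N →
      opNorm (transferMatrix V n m (E : ℂ)) ≤ C * N ^ α

/-- `N(T) = T^(1/(1+α))`. -/
noncomputable def scale (α T : ℝ) : ℝ := T ^ (1 / (1 + α))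

/-- `B(T)`, the `1/T`-neighbourhood of `A(N(T))`. -/
def energyNeighbourhood (α : ℝ) (A : ℝ → Set ℝ) (T : ℝ) : Set ℝ :=
  {E | ∃ E' ∈ A (scale α T), |E - E'| ≤ 1 / T}

end Transfer

end DiscreteSchrodinger

open DiscreteSchrodinger

/-! Write `ε = 1/T`, `z = E + iε`, `N = N(T)`, and let `u(k) = ∫₀^∞ exp(izt) ψ(t,k) dt`. Integrating
the Schrödinger equation in time shows that `u` solves `(H - z) u = -i δ_1`
(`halfLineTransform_eq`). As a function of `E`, `u(n)` is the Fourier transform of `ψ(·,n)` damped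
by `exp(-t/T)`, so Plancherel gives `∫ |u(n)|² dE = 2πT a(n,T)`. It therefore suffices to show, for
each `E ∈ B(T)`, that the sum of `|u(n)|²` over the sites with `N/2 ≤ |n| ≤ N` is at least a
constant times `N^(1-2α)` (`le_sum_norm_sq_halfLineTransform`).

Such an `E` has a neighbour `E' ∈ A(N)` with `|z - E'| ≤ 2/T = 2 N^(-1-α)`. Away from the site `1`,
`u` solves the homogeneous equation at `z`. Comparing it with the transfer matrices at `E'`, which
are bounded by `D = C N^α`, a discrete Gronwall argument bounds its growth over at most `N` steps by
`D exp(D · (2/T) · N) = C exp(2C) N^α`. The scale `N = T^(1/(1+α))` is exactly what keeps the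
exponent bounded.

The growth bound is used inwards: data of `u` at a distant site `k` control the data next to the
site `1`. The source there forbids small data on both of its sides, so on at least one side
`|u(k+1)|² + |u(k)|² ≥ q² N^(-2α)` for all `|k| ≤ N`, with `q = lowerConstant V K C`. On the
half-line it must be the right side, since `u(0) = 0`. Summing over the order of `N` outer sites on
that side gives `N^(1-2α)`. For the moments, each outer site also carries a weight of at least
`(N/2)^p`. -/

namespace DiscreteSchrodinger

/-! ### Plancherel's identity for functions in `L¹ ∩ L²` -/

section Plancherel

open FourierTransform SchwartzMap

theorem continuous_fourier_of_integrable {f : ℝ → ℂ} (hf : Integrable f) : Continuous (𝓕 f) :=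
  VectorFourier.fourierIntegral_continuous Real.continuous_fourierChar
    (by fun_prop) hf

/-- On `L¹ ∩ L²` the Fourier integral agrees with the Fourier transform on `L²`. -/
theorem coeFn_fourier_toLp {f : ℝ → ℂ} (h1 : Integrable f) (h2 : MemLp f 2) :
    ((𝓕 (h2.toLp f) : Lp (α := ℝ) ℂ 2) : ℝ → ℂ) =ᵐ[volume] 𝓕 f := by
  -- Both sides are compared as distributions. Paired with a test function `φ`, each becomes `∫ 𝓕 φ
  -- · f`: the `L²` transform through its definition on tempered distributions, the Fourier integral
  -- through Fubini.
  refine ae_eq_of_integral_contDiff_smul_eq ((Lp.memLp _).locallyIntegrable (by norm_num))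
    (continuous_fourier_of_integrable h1).locallyIntegrable fun g hg hgc => ?_
  have hg1 : HasCompactSupport (Complex.ofRealCLM ∘ g) := hgc.comp_left rfl
  have hg2 : ContDiff ℝ (⊤ : ℕ∞) (Complex.ofRealCLM ∘ g) := by fun_prop
  set φ : 𝓢(ℝ, ℂ) := hg1.toSchwartzMap hg2
  have hφ : ∀ x, φ x = (g x : ℂ) := fun x => rfl
  have key := congrArg (fun d => d φ) (Lp.fourier_toTemperedDistribution_eq (h2.toLp f))
  simp only [TemperedDistribution.fourier_apply, Lp.toTemperedDistribution_apply] at key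
  have e1 : ∀ h : ℝ → ℂ, ∫ x, g x • h x = ∫ x, φ x • h x := fun h => by
    simp only [hφ, Complex.coe_smul]
  rw [e1, e1, ← key]
  have e2 : ∫ x, (𝓕 φ) x • (h2.toLp f) x = ∫ x, (𝓕 φ) x • f x := by
    refine integral_congr_ae ?_
    filter_upwards [h2.coeFn_toLp] with x hx
    rw [hx]
  rw [e2]
  have := VectorFourier.integral_fourierIntegral_smul_eq_flip (L := innerₗ ℝ) (μ := volume)
    (ν := volume) Real.continuous_fourierChar continuous_inner φ.integrable h1
  rw [flip_innerₗ] at this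
  exact this

theorem eLpNorm_fourier_eq {f : ℝ → ℂ} (h1 : Integrable f) (h2 : MemLp f 2) :
    eLpNorm (𝓕 f) 2 volume = eLpNorm f 2 volume := by
  rw [← eLpNorm_congr_ae (coeFn_fourier_toLp h1 h2), ← eLpNorm_congr_ae h2.coeFn_toLp,
    ← Lp.enorm_def, ← Lp.enorm_def, ← ofReal_norm, ← ofReal_norm, Lp.norm_fourier_eq]

theorem lintegral_enorm_sq_fourier {f : ℝ → ℂ} (h1 : Integrable f) (h2 : MemLp f 2) :
    ∫⁻ ξ, ‖𝓕 f ξ‖ₑ ^ 2 = ∫⁻ t, ‖f t‖ₑ ^ 2 := by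
  have := eLpNorm_fourier_eq h1 h2
  rw [eLpNorm_eq_lintegral_rpow_enorm_toReal (by norm_num) (by norm_num),
    eLpNorm_eq_lintegral_rpow_enorm_toReal (by norm_num) (by norm_num)] at this
  have h := (ENNReal.rpow_left_injective (x := 1 / (2 : ℝ≥0∞).toReal) (by norm_num)) this
  simpa using h

end Plancherel

/-! ### Transfer matrices and perturbation of the energy -/

section TransferBounds

theorem det_stepMatrix (V : ℤ → ℝ) (n : ℤ) (z : ℂ) : (stepMatrix V n z).det = 1 := by
  simp [stepMatrix, Matrix.det_fin_two]

/-- Counterpart of the recursion, which adds factors on the left; varying the initial site `m`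
requires splitting off the rightmost factor. -/
theorem stepProduct_succ' (V : ℤ → ℝ) (m : ℤ) (z : ℂ) (k : ℕ) :
    stepProduct V m z (k + 1) = stepProduct V (m + 1) z k * stepMatrix V (m + 1) z := by
  induction k with
  | zero => simp [stepProduct]
  | succ k ih =>
    rw [stepProduct, ih, stepProduct, ← mul_assoc]
    congr 3
    push_cast
    ring

theorem transferMatrix_self (V : ℤ → ℝ) (n : ℤ) (z : ℂ) : transferMatrix V n n z = 1 := by
  simp [transferMatrix, stepProduct]

/-- The cocycle identity needs no assumption on the order of `n` and `k`: for `k > n` the step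
matrix cancels against the inverse, because its determinant is `1`. -/
theorem transferMatrix_mul_stepMatrix (V : ℤ → ℝ) (n k : ℤ) (z : ℂ) :
    transferMatrix V n k z * stepMatrix V k z = transferMatrix V n (k - 1) z := by
  rcases le_or_gt k n with h | h
  · rw [transferMatrix, transferMatrix, if_pos h, if_pos (by linarith),
      show (n - (k - 1)).toNat = (n - k).toNat + 1 by omega, stepProduct_succ', sub_add_cancel]
  · have e : (k - n).toNat = (k - 1 - n).toNat + 1 := by omega
    have h1 : transferMatrix V n (k - 1) z = (stepProduct V n z (k - 1 - n).toNat)⁻¹ := by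
      -- The case `k - 1 = n` falls in the non-inverted branch of `transferMatrix`, where both
      -- products are empty.
      rcases eq_or_lt_of_le (show n ≤ k - 1 by omega) with h' | h'
      · rw [← h', transferMatrix_self, sub_self, Int.toNat_zero, stepProduct, inv_one]
      · rw [transferMatrix, if_neg (by omega)]
    have e2 : n + (((k - 1 - n).toNat + 1 : ℕ) : ℤ) = k := by omega
    rw [h1, transferMatrix, if_neg (by omega), e, stepProduct, Matrix.mul_inv_rev, e2, mul_assoc,
      Matrix.nonsing_inv_mul _ (by simp [det_stepMatrix]), mul_one]

/-- The vector `(u (k+1), u k)` propagated by the transfer matrices. -/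
noncomputable def cauchyData (u : ℤ → ℂ) (k : ℤ) : EuclideanSpace ℂ (Fin 2) :=
  WithLp.toLp 2 ![u (k + 1), u k]

theorem norm_sq_cauchyData (u : ℤ → ℂ) (k : ℤ) :
    ‖cauchyData u k‖ ^ 2 = ‖u (k + 1)‖ ^ 2 + ‖u k‖ ^ 2 := by
  simp [EuclideanSpace.norm_sq_eq, cauchyData]

theorem norm_le_cauchyData (u : ℤ → ℂ) (k : ℤ) : ‖u k‖ ≤ ‖cauchyData u k‖ := by
  have := norm_sq_cauchyData u k
  nlinarith [norm_nonneg (u k), norm_nonneg (cauchyData u k), sq_nonneg ‖u (k + 1)‖]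

theorem norm_succ_le_cauchyData (u : ℤ → ℂ) (k : ℤ) : ‖u (k + 1)‖ ≤ ‖cauchyData u k‖ := by
  have := norm_sq_cauchyData u k
  nlinarith [norm_nonneg (u (k + 1)), norm_nonneg (cauchyData u k), sq_nonneg ‖u k‖]

theorem norm_toEuclideanCLM_le {M : Matrix (Fin 2) (Fin 2) ℂ} {D : ℝ} (hM : opNorm M ≤ D)
    (x : EuclideanSpace ℂ (Fin 2)) : ‖Matrix.toEuclideanCLM (𝕜 := ℂ) M x‖ ≤ D * ‖x‖ :=
  (ContinuousLinearMap.le_opNorm _ _).trans (by gcongr; exact hM)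

/-- One step taken at the energy `w` instead of `z` leaves an error in the first component only,
proportional to `z - w`. -/
theorem cauchyData_sub {V : ℤ → ℝ} {u : ℤ → ℂ} {z : ℂ} {k : ℤ} (w : ℂ)
    (hu : u (k - 1) + u (k + 1) + V k * u k = z * u k) :
    cauchyData u k - Matrix.toEuclideanCLM (𝕜 := ℂ) (stepMatrix V k w) (cauchyData u (k - 1))
      = ((z - w) * u k) • WithLp.toLp 2 ![1, 0] := by
  have h : u (k + 1) = z * u k - V k * u k - u (k - 1) := by rw [← hu]; ring
  ext i
  fin_cases i
  · simp [cauchyData, stepMatrix, h]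
    ring
  · simp [cauchyData, stepMatrix]

/-- Variation of constants: transported to the fixed site `n` at energy `w`, the data of an exact
solution at `w` would not depend on `k`. Here each increment is `T(n,k;w)` applied to the one-step
error, so only the bound on the matrices at `w` enters. -/
theorem dist_transfer_cauchyData {V : ℤ → ℝ} {u : ℤ → ℂ} {z w : ℂ} {n k : ℤ} {D δ : ℝ}
    (hu : u (k - 1) + u (k + 1) + V k * u k = z * u k)
    (hT : opNorm (transferMatrix V n k w) ≤ D) (hz : ‖z - w‖ ≤ δ) :
    dist (Matrix.toEuclideanCLM (𝕜 := ℂ) (transferMatrix V n k w) (cauchyData u k))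
      (Matrix.toEuclideanCLM (𝕜 := ℂ) (transferMatrix V n (k - 1) w) (cauchyData u (k - 1)))
      ≤ D * δ * ‖u k‖ := by
  have hD : 0 ≤ D := (norm_nonneg _).trans hT
  rw [dist_eq_norm, ← transferMatrix_mul_stepMatrix, map_mul, mul_apply_eq_comp,
    ← map_sub, cauchyData_sub w hu, mul_assoc]
  refine (norm_toEuclideanCLM_le hT _).trans ?_
  have : ‖(WithLp.toLp 2 ![1, 0] : EuclideanSpace ℂ (Fin 2))‖ = 1 := by
    simp [EuclideanSpace.norm_eq]
  rw [norm_smul, this, mul_one, norm_mul]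
  gcongr

/-- Discrete Gronwall inequality: the right-hand side of the hypothesis grows at each step by a
factor of at most `1 + c ≤ exp c`. -/
theorem le_mul_exp_of_le_add_sum {a c : ℝ} {b : ℕ → ℝ} {J : ℕ} (ha : 0 ≤ a) (hc : 0 ≤ c)
    (h : ∀ j ≤ J, b j ≤ a + ∑ i ∈ Finset.range j, c * b i) : b J ≤ a * Real.exp (c * J) := by
  have key : ∀ j ≤ J, a + ∑ i ∈ Finset.range j, c * b i ≤ a * Real.exp (c * j) := by
    intro j
    induction j with
    | zero => simp
    | succ j ih =>
      intro hj
      have h1 := ih (by omega)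
      have h2 := h j (by omega)
      rw [Finset.sum_range_succ]
      have h3 : c * b j ≤ c * (a * Real.exp (c * j)) := by gcongr; linarith
      have h4 : a * Real.exp (c * j) * (c + 1) ≤ a * Real.exp (c * j) * Real.exp c := by
        gcongr
        exact Real.add_one_le_exp c
      have h5 : Real.exp (c * (j + 1 : ℕ)) = Real.exp (c * j) * Real.exp c := by
        rw [← Real.exp_add]; push_cast; ring_nf
      rw [h5]
      linarith
  exact (h J le_rfl).trans (key J le_rfl)

/-- A transfer matrix bound at the energy `w` controls the growth to the right of solutions at
nearby energies. -/
theorem norm_cauchyData_le_of_left {V : ℤ → ℝ} {u : ℤ → ℂ} {z w : ℂ} {m : ℤ} {J : ℕ} {D δ : ℝ}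
    (hδ : 0 ≤ δ) (hu : ∀ k, m < k → k ≤ m + J → u (k - 1) + u (k + 1) + V k * u k = z * u k)
    (hT : ∀ k l, m ≤ k → k ≤ m + J → m ≤ l → l ≤ m + J → opNorm (transferMatrix V k l w) ≤ D)
    (hz : ‖z - w‖ ≤ δ) :
    ‖cauchyData u (m + J)‖ ≤ D * ‖cauchyData u m‖ * Real.exp (D * δ * J) := by
  have hD : 0 ≤ D := (norm_nonneg _).trans (hT m m le_rfl (by omega) le_rfl (by omega))
  refine le_mul_exp_of_le_add_sum (b := fun j : ℕ => ‖cauchyData u (m + j)‖) (by positivity)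
    (by positivity) fun j hj => ?_
  -- `F i` transports the data at `m + i` to `m + j` at energy `w`. Thus `F j` is the data of `u`
  -- itself, `F 0` is bounded by the matrix bound, and the increments telescope.
  set F : ℕ → EuclideanSpace ℂ (Fin 2) := fun i =>
    Matrix.toEuclideanCLM (𝕜 := ℂ) (transferMatrix V (m + j) (m + i) w) (cauchyData u (m + i))
  have h1 := dist_le_range_sum_of_dist_le (f := F) j
    (d := fun i => D * δ * ‖cauchyData u (m + i)‖) fun {i} hi => by
      have := dist_transfer_cauchyData (n := m + j) (hu (m + (i + 1 : ℕ)) (by omega) (by omega))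
        (hT (m + j) (m + (i + 1 : ℕ)) (by omega) (by omega) (by omega) (by omega)) hz
      rw [show m + ((i + 1 : ℕ) : ℤ) - 1 = m + i by push_cast; ring, dist_comm] at this
      refine this.trans ?_
      gcongr
      -- The error involves `u (m + i + 1)`, the first component of the data at `m + i`. Bounding it
      -- there keeps the sum over `i < j`, as Gronwall requires.
      rw [show m + ((i + 1 : ℕ) : ℤ) = m + i + 1 by push_cast; ring]
      exact norm_succ_le_cauchyData u (m + i)
  have hF : F j = cauchyData u (m + j) := by simp [F, transferMatrix_self]
  have h0 : ‖F 0‖ ≤ D * ‖cauchyData u m‖ := by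
    simp only [F, Nat.cast_zero, add_zero]
    exact norm_toEuclideanCLM_le (hT _ _ (by omega) (by omega) (by omega) (by omega)) _
  rw [dist_eq_norm, norm_sub_rev] at h1
  have h2 := norm_le_norm_add_norm_sub' (F j) (F 0)
  rw [hF] at h1 h2
  linarith

/-- A transfer matrix bound at the energy `w` controls the growth to the left of solutions at
nearby energies. -/
theorem norm_cauchyData_le_of_right {V : ℤ → ℝ} {u : ℤ → ℂ} {z w : ℂ} {n : ℤ} {J : ℕ} {D δ : ℝ}
    (hδ : 0 ≤ δ) (hu : ∀ k, n - J < k → k ≤ n → u (k - 1) + u (k + 1) + V k * u k = z * u k)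
    (hT : ∀ k l, n - J ≤ k → k ≤ n → n - J ≤ l → l ≤ n → opNorm (transferMatrix V k l w) ≤ D)
    (hz : ‖z - w‖ ≤ δ) :
    ‖cauchyData u (n - J)‖ ≤ D * ‖cauchyData u n‖ * Real.exp (D * δ * J) := by
  have hD : 0 ≤ D := (norm_nonneg _).trans (hT n n (by omega) le_rfl (by omega) le_rfl)
  refine le_mul_exp_of_le_add_sum (b := fun j : ℕ => ‖cauchyData u (n - j)‖) (by positivity)
    (by positivity) fun j hj => ?_
  -- The same telescoping, to the left. The error now involves `u (n - i)`, the second component of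
  -- the data at `n - i`.
  set F : ℕ → EuclideanSpace ℂ (Fin 2) := fun i =>
    Matrix.toEuclideanCLM (𝕜 := ℂ) (transferMatrix V (n - j) (n - i) w) (cauchyData u (n - i))
  have h1 := dist_le_range_sum_of_dist_le (f := F) j
    (d := fun i => D * δ * ‖cauchyData u (n - i)‖) fun {i} hi => by
      have := dist_transfer_cauchyData (n := n - j) (hu (n - i) (by omega) (by omega))
        (hT (n - j) (n - i) (by omega) (by omega) (by omega) (by omega)) hz
      rw [show n - (i : ℤ) - 1 = n - (i + 1 : ℕ) by push_cast; ring] at this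
      refine this.trans ?_
      gcongr
      exact norm_le_cauchyData u (n - i)
  have hF : F j = cauchyData u (n - j) := by simp [F, transferMatrix_self]
  have h0 : ‖F 0‖ ≤ D * ‖cauchyData u n‖ := by
    simp only [F, Nat.cast_zero, sub_zero]
    exact norm_toEuclideanCLM_le (hT _ _ (by omega) (by omega) (by omega) (by omega)) _
  rw [dist_eq_norm, norm_sub_rev] at h1
  have h2 := norm_le_norm_add_norm_sub' (F j) (F 0)
  rw [hF] at h1 h2
  linarith

end TransferBounds

/-! ### Differentiability of orbits of the unitary group -/

section Generator

variable {E : Type*} [NormedAddCommGroup E] [InnerProductSpace ℂ E]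

theorem IsUnitaryGroupGeneratedBy.zero_apply {H : E →ₗ.[ℂ] E} {U : ℝ → E ≃ₗᵢ[ℂ] E}
    (hU : IsUnitaryGroupGeneratedBy H U) (x : E) : U 0 x = x := by
  have := hU.1 0 0 x
  rw [add_zero] at this
  exact ((U 0).injective this).symm

/-- `U t` is continuous and commutes with the difference quotients of the group, hence preserves the
domain of `H` and commutes with `H`. -/
theorem IsUnitaryGroupGeneratedBy.mem_graph {H : E →ₗ.[ℂ] E} {U : ℝ → E ≃ₗᵢ[ℂ] E}
    (hU : IsUnitaryGroupGeneratedBy H U) {x y : E} (h : (x, y) ∈ H.graph) (t : ℝ) :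
    (U t x, U t y) ∈ H.graph := by
  rw [hU.2.2] at h ⊢
  have := ((U t).continuous.tendsto _).comp h
  rw [map_smul] at this
  refine this.congr fun s => ?_
  rw [Function.comp_apply, map_smul, map_sub, ← hU.1, ← hU.1, add_comm]

theorem IsUnitaryGroupGeneratedBy.hasDerivAt {H : E →ₗ.[ℂ] E} {U : ℝ → E ≃ₗᵢ[ℂ] E}
    (hU : IsUnitaryGroupGeneratedBy H U) {x y : E} (h : (x, y) ∈ H.graph) (t : ℝ) :
    HasDerivAt (fun t => U t x) (-I • U t y) t := by
  have h1 := (hU.2.2 _ _).1 (hU.mem_graph h t)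
  have h2 : HasDerivAt (fun s => U s (U t x)) (-I • U t y) 0 := by
    rw [hasDerivAt_zero_iff]
    simpa only [hU.zero_apply] using h1
  have h3 : HasDerivAt (fun s => U (s - t) (U t x)) (-I • U t y) t := by
    rw [← sub_self t] at h2
    exact h2.comp_sub_const t t
  simpa only [← hU.1, sub_add_cancel] using h3

end Generator

/-! ### The half-line transform in time and its Plancherel identity -/

section Laplace

variable (Λ : LatticeKind) (V : ℤ → ℝ)

theorem isUnitaryGroupGeneratedBy_unitaryGroup :
    IsUnitaryGroupGeneratedBy (schrodinger Λ V) (unitaryGroup Λ V) :=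
  (exists_unitaryGroup Λ V).choose_spec

theorem deltaOne_apply (n : Λ.sites) : deltaOne Λ n = if (n : ℤ) = 1 then 1 else 0 := by
  rw [deltaOne, lp.single_apply]
  by_cases h : (n : ℤ) = 1
  · obtain rfl : n = ⟨1, Λ.one_mem_sites⟩ := Subtype.ext h
    simp
  · rw [if_neg h, Pi.single_eq_of_ne]
    exact fun h' => h (congrArg Subtype.val h')

theorem norm_deltaOne : ‖deltaOne Λ‖ = 1 := by
  rw [deltaOne, lp.norm_single (by norm_num), norm_one]

/-- Even for unbounded `V`, `δ_1` lies in the domain because it has finite support; this makes `t ↦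
ψ(t,·)` differentiable. -/
theorem exists_mem_graph_deltaOne : ∃ y, (deltaOne Λ, y) ∈ (schrodinger Λ V).graph := by
  refine ⟨shift (-1) (deltaOne Λ) + shift 1 (deltaOne Λ) + (V 1 : ℂ) • deltaOne Λ, ?_⟩
  rw [mem_graph_schrodinger]
  intro n
  have e : (V 1 : ℂ) * deltaOne Λ n = V n * deltaOne Λ n := by
    rw [deltaOne_apply]
    split_ifs with h <;> simp [h]
  rw [formalOperator, ← e]
  rfl

/-- `ψ(t,k)` extended by zero to all `k ∈ ℤ`. -/
noncomputable def wave (t : ℝ) (k : ℤ) : ℂ := extendZero (unitaryGroup Λ V t (deltaOne Λ)) k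

variable {Λ V}

theorem wave_of_notMem {k : ℤ} (hk : k ∉ Λ.sites) (t : ℝ) : wave Λ V t k = 0 :=
  Function.extend_apply' _ _ _ (by simpa using hk)

theorem wave_apply (n : Λ.sites) (t : ℝ) : wave Λ V t n = amplitude Λ V t n := extendZero_apply _ n

theorem wave_zero {k : ℤ} (hk : k ∈ Λ.sites) : wave Λ V 0 k = if k = 1 then 1 else 0 := by
  lift k to Λ.sites using hk
  rw [wave_apply, amplitude, (isUnitaryGroupGeneratedBy_unitaryGroup Λ V).zero_apply,
    deltaOne_apply]

theorem norm_wave_le (t : ℝ) (k : ℤ) : ‖wave Λ V t k‖ ≤ 1 := by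
  by_cases hk : k ∈ Λ.sites
  · lift k to Λ.sites using hk
    rw [wave_apply, amplitude]
    refine (lp.norm_apply_le_norm (by norm_num) _ _).trans ?_
    rw [LinearIsometryEquiv.norm_map, norm_deltaOne]
  · simp [wave_of_notMem hk]

theorem continuous_wave (k : ℤ) : Continuous fun t => wave Λ V t k := by
  by_cases hk : k ∈ Λ.sites
  · lift k to Λ.sites using hk
    simp only [wave_apply]
    exact (lp.evalCLM ℂ (fun _ : Λ.sites => ℂ) 2 k).continuous.comp
      ((isUnitaryGroupGeneratedBy_unitaryGroup Λ V).2.1 (deltaOne Λ))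
  · simp only [wave_of_notMem hk]
    exact continuous_const

theorem hasDerivAt_wave {k : ℤ} (hk : k ∈ Λ.sites) (t : ℝ) :
    HasDerivAt (fun t => wave Λ V t k)
      (-I * (wave Λ V t (k - 1) + wave Λ V t (k + 1) + V k * wave Λ V t k)) t := by
  lift k to Λ.sites using hk
  obtain ⟨y, hy⟩ := exists_mem_graph_deltaOne Λ V
  have hU := isUnitaryGroupGeneratedBy_unitaryGroup Λ V
  have h1 := ((lp.evalCLM ℂ (fun _ : Λ.sites => ℂ) 2 k).restrictScalars ℝ).hasFDerivAt.comp_hasDerivAt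
    t (hU.hasDerivAt hy t)
  have h2 := (mem_graph_schrodinger V _ _).1 (hU.mem_graph hy t) k
  refine (h1.congr_deriv ?_).congr_of_eventuallyEq (Eventually.of_forall fun s => wave_apply k s)
  change -I * unitaryGroup Λ V t y k = _
  rw [h2, formalOperator, wave_apply k t]
  rfl

variable (Λ V) in
/-- The half-line Fourier transform of `t ↦ ψ(t,k)`; up to a factor this is the resolvent
`(H - z)⁻¹ δ_1`. -/
noncomputable def halfLineTransform (z : ℂ) (k : ℤ) : ℂ :=
  ∫ t in Ioi (0 : ℝ), cexp (I * z * t) * wave Λ V t k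

theorem norm_cexp_I_mul (z : ℂ) (t : ℝ) : ‖cexp (I * z * t)‖ = Real.exp (-z.im * t) := by
  rw [Complex.norm_exp]
  simp

theorem integrableOn_cexp_mul_wave {z : ℂ} (hz : 0 < z.im) (k : ℤ) :
    IntegrableOn (fun t : ℝ => cexp (I * z * t) * wave Λ V t k) (Ioi 0) := by
  refine Integrable.mono' (integrableOn_exp_mul_Ioi (neg_neg_of_pos hz) 0)
    (((by fun_prop : Continuous fun t : ℝ => cexp (I * z * t)).mul
      (continuous_wave k)).aestronglyMeasurable) (Eventually.of_forall fun t => ?_)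
  rw [norm_mul, norm_cexp_I_mul]
  exact mul_le_of_le_one_right (Real.exp_pos _).le (norm_wave_le t k)

theorem halfLineTransform_of_notMem {k : ℤ} (hk : k ∉ Λ.sites) (z : ℂ) :
    halfLineTransform Λ V z k = 0 := by
  simp [halfLineTransform, wave_of_notMem hk]

/-- Integrate the time derivative of `exp(izt) ψ(t,k)` over `(0,∞)`. The boundary term at infinity
vanishes since `Im z > 0` and `|ψ| ≤ 1`; the one at `0` is the initial state and produces the
source. -/
theorem halfLineTransform_eq {z : ℂ} (hz : 0 < z.im) {k : ℤ} (hk : k ∈ Λ.sites) :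
    halfLineTransform Λ V z (k - 1) + halfLineTransform Λ V z (k + 1)
      + V k * halfLineTransform Λ V z k
      = z * halfLineTransform Λ V z k - I * (if k = 1 then 1 else 0) := by
  have hi := fun j => integrableOn_cexp_mul_wave (Λ := Λ) (V := V) hz j
  have hadd : IntegrableOn (fun t : ℝ => cexp (I * z * t) * wave Λ V t (k - 1)
      + cexp (I * z * t) * wave Λ V t (k + 1)) (Ioi 0) := (hi (k - 1)).add (hi (k + 1))
  have hH : IntegrableOn (fun t : ℝ => cexp (I * z * t) * wave Λ V t (k - 1)
      + cexp (I * z * t) * wave Λ V t (k + 1) + V k * (cexp (I * z * t) * wave Λ V t k)) (Ioi 0) :=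
    hadd.add ((hi k).const_mul _)
  have hd : ∀ t ∈ Ici (0 : ℝ), HasDerivAt (fun t : ℝ => cexp (I * z * t) * wave Λ V t k)
      (I * z * (cexp (I * z * t) * wave Λ V t k)
      - I * (cexp (I * z * t) * wave Λ V t (k - 1) + cexp (I * z * t) * wave Λ V t (k + 1)
        + V k * (cexp (I * z * t) * wave Λ V t k))) t := fun t _ => by
    have h1 : HasDerivAt (fun t : ℝ => cexp (I * z * t)) (cexp (I * z * t) * (I * z)) t := by
      have := (((hasDerivAt_id t).ofReal_comp).const_mul (I * z)).cexp
      simpa using this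
    refine (h1.mul (hasDerivAt_wave (V := V) hk t)).congr_deriv ?_
    ring
  have hlim : Tendsto (fun t : ℝ => cexp (I * z * t) * wave Λ V t k) atTop (𝓝 0) := by
    have h0 : Tendsto (fun t : ℝ => Real.exp (-z.im * t)) atTop (𝓝 0) :=
      Real.tendsto_exp_atBot.comp
        (tendsto_id.const_mul_atTop_of_neg (neg_neg_of_pos hz))
    refine squeeze_zero_norm (fun t => ?_) h0
    rw [norm_mul, norm_cexp_I_mul]
    exact mul_le_of_le_one_right (Real.exp_pos _).le (norm_wave_le t k)
  have h := integral_Ioi_of_hasDerivAt_of_tendsto' hd (((hi k).const_mul _).sub (hH.const_mul _)) hlim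
  rw [integral_sub ((hi k).const_mul _) (hH.const_mul _), integral_const_mul, integral_const_mul,
    integral_add hadd ((hi k).const_mul _), integral_add (hi (k - 1)) (hi (k + 1)),
    integral_const_mul, wave_zero hk] at h
  simp only [ofReal_zero, mul_zero, Complex.exp_zero, one_mul, zero_sub] at h
  change I * z * halfLineTransform Λ V z k - I * (halfLineTransform Λ V z (k - 1)
    + halfLineTransform Λ V z (k + 1) + V k * halfLineTransform Λ V z k) = _ at h
  linear_combination I * h + (halfLineTransform Λ V z (k - 1) + halfLineTransform Λ V z (k + 1)
    + V k * halfLineTransform Λ V z k - z * halfLineTransform Λ V z k) * I_sq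

variable (Λ V) in
/-- `ψ(t,k)` damped by `exp (-ε t)` and cut off to positive times. -/
noncomputable def dampedWave (ε : ℝ) (k : ℤ) : ℝ → ℂ :=
  (Ioi (0 : ℝ)).indicator fun t => ((Real.exp (-ε * t) : ℝ) : ℂ) * wave Λ V t k

theorem integrable_dampedWave {ε : ℝ} (hε : 0 < ε) (k : ℤ) : Integrable (dampedWave Λ V ε k) := by
  rw [dampedWave, integrable_indicator_iff measurableSet_Ioi]
  have := integrableOn_cexp_mul_wave (Λ := Λ) (V := V) (z := ε * I) (by simpa using hε) k
  refine this.congr_fun (fun t _ => ?_) measurableSet_Ioi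
  simp only
  congr 1
  rw [ofReal_exp]
  congr 1
  push_cast
  linear_combination (ε * t : ℂ) * I_sq

theorem norm_dampedWave_le {ε : ℝ} (hε : 0 < ε) (k : ℤ) (t : ℝ) : ‖dampedWave Λ V ε k t‖ ≤ 1 := by
  rw [dampedWave, indicator_apply]
  split_ifs with ht
  · rw [norm_mul, norm_real, Real.norm_eq_abs, Real.abs_exp]
    refine mul_le_one₀ (Real.exp_le_one_iff.2 ?_) (norm_nonneg _) (norm_wave_le t k)
    have : 0 < ε * t := mul_pos hε ht
    linarith
  · simp

theorem memLp_two_dampedWave {ε : ℝ} (hε : 0 < ε) (k : ℤ) : MemLp (dampedWave Λ V ε k) 2 := by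
  have h := integrable_dampedWave (Λ := Λ) (V := V) hε k
  rw [memLp_two_iff_integrable_sq_norm h.1]
  refine h.norm.mono' (h.1.norm.pow 2) (Eventually.of_forall fun t => ?_)
  have := norm_dampedWave_le (Λ := Λ) (V := V) hε k t
  rw [Real.norm_eq_abs, abs_of_nonneg (by positivity)]
  nlinarith [norm_nonneg (dampedWave Λ V ε k t)]

/-- The Fourier kernel `exp(-2πitξ)` corresponds to the energy `-2πξ`, and the damping rate becomes
the imaginary part of `z`. -/
theorem fourier_dampedWave (ε : ℝ) (k : ℤ) (ξ : ℝ) :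
    FourierTransform.fourier (dampedWave Λ V ε k) ξ
      = halfLineTransform Λ V (((-(2 * Real.pi) * ξ : ℝ) : ℂ) + ε * I) k := by
  rw [Real.fourier_eq', halfLineTransform, ← integral_indicator measurableSet_Ioi]
  congr 1
  ext t
  rw [dampedWave, indicator_apply, indicator_apply]
  split_ifs
  · rw [smul_eq_mul, ← mul_assoc, ofReal_exp, ← Complex.exp_add]
    congr 2
    simp only [RCLike.inner_apply, conj_trivial]
    push_cast
    linear_combination (-ε * t : ℂ) * I_sq
  · simp

/-- The damping rate `1/T` is chosen so that its square is the weight `exp(-2t/T)` of the time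
average. -/
theorem lintegral_dampedWave {T : ℝ} (hT : 0 < T) (n : Λ.sites) :
    ∫⁻ t, ‖dampedWave Λ V (1 / T) n t‖ₑ ^ 2 = ENNReal.ofReal (T * timeAverage Λ V n T) := by
  have h := memLp_two_dampedWave (Λ := Λ) (V := V) (one_div_pos.2 hT) n
  have h2 := (memLp_two_iff_integrable_sq_norm h.1).1 h
  have e : T * timeAverage Λ V n T = ∫ t, ‖dampedWave Λ V (1 / T) n t‖ ^ 2 := by
    rw [timeAverage, ← mul_assoc, mul_one_div_cancel hT.ne', one_mul,
      ← integral_indicator measurableSet_Ioi]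
    congr 1
    ext t
    rw [dampedWave, indicator_apply, indicator_apply]
    split_ifs
    · rw [norm_mul, norm_real, Real.norm_eq_abs, Real.abs_exp, mul_pow, ← Real.exp_nat_mul,
        wave_apply]
      congr 2
      push_cast
      ring
    · simp
  rw [e, ofReal_integral_eq_lintegral_ofReal h2 (Eventually.of_forall fun t => by positivity)]
  refine lintegral_congr fun t => ?_
  rw [ENNReal.ofReal_pow (norm_nonneg _), ofReal_norm]

/-- Plancherel's identity turns a pointwise lower bound on the transforms, over a set `B` of
energies, into a lower bound on the time averages. -/
theorem ofReal_mul_volume_le_sum_timeAverage {T c : ℝ} (hT : 0 < T) (F : Finset Λ.sites)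
    {B : Set ℝ}
    (hB : ∀ E ∈ B, c ≤ ∑ n ∈ F, ‖halfLineTransform Λ V ((E : ℂ) + (1 / T : ℝ) * I) n‖ ^ 2) :
    ENNReal.ofReal c * volume B
      ≤ ENNReal.ofReal (2 * Real.pi * T) * ∑ n ∈ F, ENNReal.ofReal (timeAverage Λ V n T) := by
  have hε := one_div_pos.2 hT
  set G : ℝ → ℝ≥0∞ := fun ξ =>
    ∑ n ∈ F, ‖FourierTransform.fourier (dampedWave Λ V (1 / T) n) ξ‖ₑ ^ 2
  have hm : ∀ n : Λ.sites, Measurable fun ξ =>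
      ‖FourierTransform.fourier (dampedWave Λ V (1 / T) n) ξ‖ₑ ^ 2 := fun n =>
    (continuous_fourier_of_integrable (integrable_dampedWave hε n)).measurable.enorm.pow_const 2
  have hG : ∫⁻ ξ, G ξ = ENNReal.ofReal T * ∑ n ∈ F, ENNReal.ofReal (timeAverage Λ V n T) := by
    rw [lintegral_finsetSum _ fun n _ => hm n, Finset.mul_sum]
    refine Finset.sum_congr rfl fun n _ => ?_
    rw [lintegral_enorm_sq_fourier (integrable_dampedWave hε n) (memLp_two_dampedWave hε n),
      lintegral_dampedWave hT, ENNReal.ofReal_mul hT.le]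
  -- Markov's inequality is applied to a superlevel set of the measurable function `G`, which
  -- contains the rescaled `B`; no measurability of `B` is needed.
  have hmarkov := mul_meas_ge_le_lintegral (μ := volume)
    (Finset.measurable_fun_sum F fun n _ => hm n : Measurable G) (ENNReal.ofReal c)
  have hne : (-(2 * Real.pi)) ≠ 0 := neg_ne_zero.2 Real.two_pi_pos.ne'
  -- The substitution `E = -2πξ` scales the measure by `1/(2π)`, whence the factor `2π` in the
  -- result.
  have hsub : ((-(2 * Real.pi)) * ·) ⁻¹' B ⊆ {ξ | ENNReal.ofReal c ≤ G ξ} := by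
    intro ξ hξ
    have h1 := hB _ hξ
    refine (ENNReal.ofReal_le_ofReal h1).trans ?_
    rw [ENNReal.ofReal_sum_of_nonneg fun n _ => by positivity]
    refine Finset.sum_le_sum fun n _ => ?_
    rw [fourier_dampedWave, ENNReal.ofReal_pow (norm_nonneg _), ofReal_norm]
  have hvol := measure_mono (μ := volume) hsub
  rw [Real.volume_preimage_mul_left hne, abs_inv, abs_neg, abs_of_pos Real.two_pi_pos] at hvol
  have hone : ENNReal.ofReal (2 * Real.pi) * ENNReal.ofReal (2 * Real.pi)⁻¹ = 1 := by
    rw [← ENNReal.ofReal_mul Real.two_pi_pos.le, mul_inv_cancel₀ Real.two_pi_pos.ne',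
      ENNReal.ofReal_one]
  calc ENNReal.ofReal c * volume B
      = ENNReal.ofReal (2 * Real.pi)
          * (ENNReal.ofReal c * (ENNReal.ofReal (2 * Real.pi)⁻¹ * volume B)) := by
        rw [mul_left_comm (ENNReal.ofReal c), ← mul_assoc, hone, one_mul]
    _ ≤ ENNReal.ofReal (2 * Real.pi) * ∫⁻ ξ, G ξ := by
        gcongr
        exact (mul_le_mul_right hvol _).trans hmarkov
    _ = _ := by rw [hG, ← mul_assoc, ← ENNReal.ofReal_mul Real.two_pi_pos.le]

end Laplace

/-! ### Summation over the outer sites -/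

section OuterSites

/-- There are `b - a` consecutive pairs, and each site belongs to at most two of them. -/
theorem mul_le_two_mul_sum_Icc {f : ℤ → ℝ} (hf : ∀ k, 0 ≤ f k) {η : ℝ} {a b : ℤ} (hab : a ≤ b)
    (h : ∀ k, a ≤ k → k < b → η ≤ f (k + 1) + f k) :
    ((b : ℝ) - a) * η ≤ 2 * ∑ k ∈ Finset.Icc a b, f k := by
  have h1 : ∑ k ∈ Finset.Ico a b, f (k + 1) ≤ ∑ k ∈ Finset.Icc a b, f k := by
    have := Finset.sum_map (Finset.Ico a b) (addRightEmbedding (1 : ℤ)) f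
    rw [Finset.map_add_right_Ico] at this
    refine this.symm.le.trans (Finset.sum_le_sum_of_subset_of_nonneg (fun k hk => ?_)
      fun k _ _ => hf k)
    rw [Finset.mem_Ico] at hk
    exact Finset.mem_Icc.2 ⟨by omega, by omega⟩
  have h2 : ∑ k ∈ Finset.Ico a b, f k ≤ ∑ k ∈ Finset.Icc a b, f k :=
    Finset.sum_le_sum_of_subset_of_nonneg Finset.Ico_subset_Icc_self fun k _ _ => hf k
  have h3 := Finset.card_nsmul_le_sum (Finset.Ico a b) (fun k => f (k + 1) + f k) η
    fun k hk => h k (Finset.mem_Ico.1 hk).1 (Finset.mem_Ico.1 hk).2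
  rw [Finset.sum_add_distrib, Int.card_Ico, nsmul_eq_mul] at h3
  have h4 : (((b - a).toNat : ℕ) : ℝ) = (b : ℝ) - a := by
    have : (((b - a).toNat : ℕ) : ℤ) = b - a := Int.toNat_of_nonneg (by omega)
    exact_mod_cast congrArg (Int.cast : ℤ → ℝ) this
  rw [h4] at h3
  linarith

open Classical in
/-- The sites with `N / 2 ≤ |n| ≤ N`. -/
noncomputable def outerSites (Λ : LatticeKind) (N : ℝ) : Finset Λ.sites :=
  ((Finset.Icc (-⌊N⌋) ⌊N⌋).filter fun k : ℤ => N / 2 ≤ |(k : ℝ)|).subtype (· ∈ Λ.sites)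

theorem half_le_of_mem_outerSites {Λ : LatticeKind} {N : ℝ} {n : Λ.sites}
    (hn : n ∈ outerSites Λ N) : N / 2 ≤ |((n : ℤ) : ℝ)| := by
  classical
  rw [outerSites, Finset.mem_subtype, Finset.mem_filter] at hn
  exact hn.2

theorem sum_Icc_le_sum_outerSites {Λ : LatticeKind} {N : ℝ} {f : ℤ → ℝ} (hf : ∀ k, 0 ≤ f k)
    {a b : ℤ} (h : ∀ k, a ≤ k → k ≤ b → k ∈ Λ.sites ∧ N / 2 ≤ |(k : ℝ)| ∧ |(k : ℝ)| ≤ N) :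
    ∑ k ∈ Finset.Icc a b, f k ≤ ∑ n ∈ outerSites Λ N, f n := by
  classical
  rw [outerSites, Finset.sum_subtype_eq_sum_filter]
  refine Finset.sum_le_sum_of_subset_of_nonneg (fun k hk => ?_) fun k _ _ => hf k
  rw [Finset.mem_Icc] at hk
  obtain ⟨h1, h2, h3⟩ := h k hk.1 hk.2
  rw [abs_le] at h3
  refine Finset.mem_filter.2 ⟨Finset.mem_filter.2 ⟨Finset.mem_Icc.2 ⟨?_, Int.le_floor.2 h3.2⟩, h2⟩,
    h1⟩
  have := Int.le_floor.2 (show ((-k : ℤ) : ℝ) ≤ N by push_cast; linarith)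
  omega

theorem quarter_mul_le_two_mul_sum_outerSites_of_right {Λ : LatticeKind} {N : ℝ} (hN : 8 ≤ N)
    {f : ℤ → ℝ} (hf : ∀ k, 0 ≤ f k) {η : ℝ} (hη : 0 ≤ η)
    (h : ∀ k : ℤ, 1 ≤ k → (k : ℝ) ≤ N → η ≤ f (k + 1) + f k) :
    N / 4 * η ≤ 2 * ∑ n ∈ outerSites Λ N, f n := by
  have ha := Int.le_ceil (N / 2)
  have ha' := Int.ceil_lt_add_one (N / 2)
  have hb := Int.floor_le N
  have hb' := Int.lt_floor_add_one N
  have hab : ⌈N / 2⌉ ≤ ⌊N⌋ := by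
    have : ((⌈N / 2⌉ : ℤ) : ℝ) ≤ (⌊N⌋ : ℤ) := by linarith
    exact_mod_cast this
  have hpos : ∀ k : ℤ, ⌈N / 2⌉ ≤ k → N / 2 ≤ k := fun k hk => Int.ceil_le.1 hk
  have hone : ∀ k : ℤ, ⌈N / 2⌉ ≤ k → 1 ≤ k := fun k hk => by
    have : (1 : ℝ) ≤ k := by linarith [hpos k hk]
    exact_mod_cast this
  have h1 := mul_le_two_mul_sum_Icc hf hab (η := η) fun k hk hk' =>
    h k (hone k hk) (Int.le_floor.1 hk'.le)
  have h2 := sum_Icc_le_sum_outerSites (Λ := Λ) (N := N) hf (a := ⌈N / 2⌉) (b := ⌊N⌋)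
    fun k hk hk' => by
      have h3 := hpos k hk
      have h4 := Int.le_floor.1 hk'
      have h5 := hone k hk
      rw [abs_of_nonneg (by linarith : (0 : ℝ) ≤ k)]
      refine ⟨?_, h3, h4⟩
      cases Λ
      · exact mem_univ k
      · exact h5
  -- The interval has length at least `(N - 1) - (N/2 + 1) = N/2 - 2`, which is at least `N/4` once
  -- `N ≥ 8`.
  have h3 : N / 4 * η ≤ ((⌊N⌋ : ℤ) - (⌈N / 2⌉ : ℤ) : ℝ) * η := by
    gcongr
    linarith
  linarith

theorem quarter_mul_le_two_mul_sum_outerSites_of_left {N : ℝ} (hN : 8 ≤ N)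
    {f : ℤ → ℝ} (hf : ∀ k, 0 ≤ f k) {η : ℝ} (hη : 0 ≤ η)
    (h : ∀ k : ℤ, k < 0 → -(k : ℝ) ≤ N → η ≤ f (k + 1) + f k) :
    N / 4 * η ≤ 2 * ∑ n ∈ outerSites .wholeLine N, f n := by
  have ha := Int.le_ceil (N / 2)
  have ha' := Int.ceil_lt_add_one (N / 2)
  have hb := Int.floor_le N
  have hb' := Int.lt_floor_add_one N
  have hab : -⌊N⌋ ≤ -⌈N / 2⌉ := by
    have : ((⌈N / 2⌉ : ℤ) : ℝ) ≤ (⌊N⌋ : ℤ) := by linarith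
    have : ⌈N / 2⌉ ≤ ⌊N⌋ := by exact_mod_cast this
    omega
  have hneg : ∀ k : ℤ, k ≤ -⌈N / 2⌉ → (k : ℝ) ≤ -(N / 2) := fun k hk => by
    have := Int.ceil_le.1 (show ⌈N / 2⌉ ≤ -k by omega)
    push_cast at this
    linarith
  have hle : ∀ k : ℤ, -⌊N⌋ ≤ k → -(k : ℝ) ≤ N := fun k hk => by
    have := Int.le_floor.1 (show -k ≤ ⌊N⌋ by omega)
    push_cast at this
    linarith
  have h1 := mul_le_two_mul_sum_Icc hf hab (η := η) fun k hk hk' => h k (by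
    have : (k : ℝ) < 0 := by linarith [hneg k hk'.le]
    exact_mod_cast this) (hle k hk)
  have h2 := sum_Icc_le_sum_outerSites (Λ := .wholeLine) (N := N) hf (a := -⌊N⌋) (b := -⌈N / 2⌉)
    fun k hk hk' => by
      have h3 := hneg k hk'
      rw [abs_of_neg (by linarith : (k : ℝ) < 0)]
      exact ⟨mem_univ k, by linarith, hle k hk⟩
  have h3 : N / 4 * η ≤ (((-⌈N / 2⌉ : ℤ) : ℝ) - ((-⌊N⌋ : ℤ) : ℝ)) * η := by
    gcongr
    push_cast
    linarith
  linarith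

end OuterSites

/-! ### Lower bounds for the transform, the outside probability and the moments -/

section LowerBounds

variable {Λ : LatticeKind} {V : ℤ → ℝ}

/-- The source term at the site `1` prevents the Cauchy data next to it from being small. -/
theorem one_le_mul_add_norm_cauchyData {u : ℤ → ℂ} {z : ℂ} {L : ℝ}
    (hu : u 0 + u 2 + V 1 * u 1 = z * u 1 - I) (hL : |V 1| + ‖z‖ ≤ L) :
    1 ≤ ‖u 0‖ + (1 + L) * ‖cauchyData u 1‖ := by
  have h1 : I = (z - V 1) * u 1 - u 2 - u 0 := by linear_combination hu
  have h2 : ‖z - V 1‖ ≤ L := (norm_sub_le _ _).trans (by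
    rw [Complex.norm_real, Real.norm_eq_abs]; linarith)
  have h3 := norm_le_cauchyData u 1
  have h4 : ‖u 2‖ ≤ ‖cauchyData u 1‖ := norm_succ_le_cauchyData u 1
  calc (1 : ℝ) = ‖(z - V 1) * u 1 - u 2 - u 0‖ := by rw [← h1, norm_I]
    _ ≤ ‖z - V 1‖ * ‖u 1‖ + ‖u 2‖ + ‖u 0‖ :=
      (norm_sub_le _ _).trans (by gcongr; exact (norm_sub_le _ _).trans (by rw [norm_mul]))
    _ ≤ L * ‖cauchyData u 1‖ + ‖cauchyData u 1‖ + ‖u 0‖ := by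
      gcongr
      exact (norm_nonneg _).trans h2
    _ = _ := by ring

/-- The constant in the lower bound for the transforms. -/
noncomputable def lowerConstant (V : ℤ → ℝ) (K C : ℝ) : ℝ :=
  (2 * (1 + (|V 1| + K + 2)) * (C * Real.exp (2 * C)))⁻¹

theorem lowerConstant_pos (V : ℤ → ℝ) {K C : ℝ} (hK : 0 < K) (hC : 0 < C) :
    0 < lowerConstant V K C := by
  rw [lowerConstant]
  positivity

/-- If the bound `D = C N^α` propagates Cauchy data of size `1 / (2 (1 + L))`, then the data
reached have size at least `lowerConstant V K C * N^(-α)`. -/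
theorem lowerConstant_sq_mul_le {K C α N T x y : ℝ} {J : ℕ} (hK : 0 < K) (hC : 0 < C) (hN : 0 < N)
    (hT : N ^ (1 + α) = T) (hJ : (J : ℝ) ≤ N) (hy : 0 ≤ y)
    (hx : (2 * (1 + (|V 1| + K + 2)))⁻¹ ≤ x)
    (hxy : x ≤ C * N ^ α * y * Real.exp (C * N ^ α * (2 / T) * J)) :
    lowerConstant V K C ^ 2 * N ^ (-2 * α) ≤ y ^ 2 := by
  have hNα : 0 < N ^ α := Real.rpow_pos_of_pos hN α
  have hT0 : 0 < T := hT ▸ Real.rpow_pos_of_pos hN _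
  have hTN : T = N * N ^ α := by rw [← hT, Real.rpow_add hN, Real.rpow_one]
  -- The relation `T = N^(1+α)` enters here: over at most `N` steps the accumulated perturbation is
  -- bounded independently of `N`.
  have hexp : C * N ^ α * (2 / T) * J ≤ 2 * C := by
    calc C * N ^ α * (2 / T) * J ≤ C * N ^ α * (2 / T) * N := by gcongr
      _ = 2 * C := by rw [hTN]; field_simp
  have h1 : (2 * (1 + (|V 1| + K + 2)))⁻¹ ≤ C * N ^ α * y * Real.exp (2 * C) :=
    hx.trans (hxy.trans (by gcongr))
  have h2 : lowerConstant V K C * N ^ (-α) ≤ y := by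
    rw [Real.rpow_neg hN.le, ← div_eq_mul_inv, div_le_iff₀ hNα, lowerConstant, mul_inv,
      ← div_eq_mul_inv, div_le_iff₀ (by positivity)]
    linarith
  have h3 : N ^ (-2 * α) = (N ^ (-α)) ^ 2 := by
    rw [← Real.rpow_natCast, ← Real.rpow_mul hN.le]
    congr 1
    push_cast
    ring
  rw [h3, ← mul_pow]
  have := lowerConstant_pos V hK hC
  gcongr

/-- Small data at a distant site would propagate inwards to small data beside the site `1`, against
the source term. The side on which the data are not small is found by cases, and the outer sites on
that side suffice. -/
theorem le_sum_norm_sq_halfLineTransform {K C α N T E E' : ℝ} (hK : 0 < K) (hC : 0 < C)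
    (hN : 8 ≤ N) (hT1 : 1 ≤ T) (hT : N ^ (1 + α) = T) (hE' : E' ∈ Icc (-K) K)
    (hbound : ∀ n ∈ Λ.sites, ∀ m ∈ Λ.sites, |(n : ℝ)| ≤ N → |(m : ℝ)| ≤ N →
      opNorm (transferMatrix V n m (E' : ℂ)) ≤ C * N ^ α)
    (hEE' : |E - E'| ≤ 1 / T) :
    lowerConstant V K C ^ 2 / 8 * N ^ (1 - 2 * α)
      ≤ ∑ n ∈ outerSites Λ N, ‖halfLineTransform Λ V ((E : ℂ) + (1 / T : ℝ) * I) n‖ ^ 2 := by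
  set z : ℂ := (E : ℂ) + (1 / T : ℝ) * I with hz
  set u : ℤ → ℂ := halfLineTransform Λ V z
  have hT0 : 0 < T := by linarith
  have hN0 : 0 < N := by linarith
  have hzim : 0 < z.im := by
    have : z.im = 1 / T := by simp [hz]
    rw [this]
    positivity
  have hzE : ‖z - (E' : ℂ)‖ ≤ 2 / T := by
    have e : z - (E' : ℂ) = ((E - E' : ℝ) : ℂ) + (1 / T : ℝ) * I := by rw [hz]; push_cast; ring
    rw [e]
    refine (norm_add_le _ _).trans ?_
    rw [norm_mul, norm_I, mul_one, norm_real, norm_real, Real.norm_eq_abs, Real.norm_eq_abs,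
      abs_of_pos (one_div_pos.2 hT0)]
    calc |E - E'| + 1 / T ≤ 1 / T + 1 / T := by gcongr
      _ = 2 / T := by ring
  -- Uniform in `E` and `T ≥ 1`, so that `L` below depends only on `V` and `K`.
  have hz2 : ‖z‖ ≤ K + 2 := by
    have h1 : ‖z‖ ≤ ‖(E' : ℂ)‖ + ‖z - (E' : ℂ)‖ := norm_le_norm_add_norm_sub' _ _
    have h2 : ‖(E' : ℂ)‖ ≤ K := by
      rw [norm_real, Real.norm_eq_abs]
      exact abs_le.2 hE'
    have h3 : 2 / T ≤ 2 := div_le_self (by norm_num) hT1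
    linarith
  have hrec : ∀ k ∈ Λ.sites, k ≠ 1 → u (k - 1) + u (k + 1) + V k * u k = z * u k := by
    intro k hk hk1
    have := halfLineTransform_eq (Λ := Λ) (V := V) hzim hk
    rwa [if_neg hk1, mul_zero, sub_zero] at this
  have hsrc : u 0 + u 2 + V 1 * u 1 = z * u 1 - I := by
    have := halfLineTransform_eq (Λ := Λ) (V := V) hzim Λ.one_mem_sites
    rwa [if_pos rfl, mul_one] at this
  set L : ℝ := |V 1| + K + 2 with hL
  have hone := one_le_mul_add_norm_cauchyData hsrc (show |V 1| + ‖z‖ ≤ L by linarith)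
  have hL0 : 0 < 1 + L := by positivity
  have hq := lowerConstant_pos V hK hC
  set η : ℝ := lowerConstant V K C ^ 2 * N ^ (-2 * α) with hη
  have hη0 : 0 ≤ η := by positivity
  have hsites : ∀ k : ℤ, 1 ≤ k → k ∈ Λ.sites := fun k hk => by
    cases Λ
    · exact mem_univ k
    · exact hk
  have hf : ∀ k, 0 ≤ ‖u k‖ ^ 2 := fun k => by positivity
  have main : N / 4 * η ≤ 2 * ∑ n ∈ outerSites Λ N, ‖u n‖ ^ 2 := by
    -- The source gives `1 ≤ ‖u 0‖ + (1 + L) ‖cauchyData u 1‖`, so the two terms cannot both be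
    -- below `1/2`.
    by_cases h1 : (2 * (1 + L))⁻¹ ≤ ‖cauchyData u 1‖
    · refine quarter_mul_le_two_mul_sum_outerSites_of_right (f := fun k => ‖u k‖ ^ 2) hN hf hη0
        fun k hk hkN => ?_
      -- Going from `k` down to the data at `1`, that is `(u 2, u 1)`, uses the equation at the
      -- sites `2, …, k`, which carry no source, and matrices between sites in `[1, k]`, the only
      -- ones bounded on the half-line.
      have hkJ : k - ((k - 1).toNat : ℤ) = 1 := by omega
      have hJ : (((k - 1).toNat : ℕ) : ℝ) ≤ N := by
        have : (((k - 1).toNat : ℕ) : ℤ) = k - 1 := by omega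
        have : (((k - 1).toNat : ℕ) : ℝ) = (k : ℝ) - 1 := by
          exact_mod_cast congrArg (Int.cast : ℤ → ℝ) this
        linarith
      have habs : ∀ j : ℤ, 1 ≤ j → j ≤ k → |(j : ℝ)| ≤ N := fun j hj hjk => by
        have h3 : (1 : ℝ) ≤ j := by exact_mod_cast hj
        have h4 : (j : ℝ) ≤ k := by exact_mod_cast hjk
        rw [abs_of_nonneg (by linarith)]
        linarith
      have h2 := norm_cauchyData_le_of_right (V := V) (u := u) (z := z) (w := E') (n := k)
        (J := (k - 1).toNat) (D := C * N ^ α) (δ := 2 / T) (by positivity)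
        (fun j hj hjk => hrec j (hsites j (by omega)) (by omega))
        (fun i j hi hik hj hjk => hbound i (hsites i (by omega)) j (hsites j (by omega))
          (habs i (by omega) hik) (habs j (by omega) hjk)) hzE
      rw [hkJ] at h2
      rw [← norm_sq_cauchyData]
      exact lowerConstant_sq_mul_le hK hC hN0 hT hJ (norm_nonneg _) h1 h2
    · have h0 : (2 * (1 + L))⁻¹ ≤ ‖u 0‖ := by
        have e : (1 + L) * (2 * (1 + L))⁻¹ = 1 / 2 := by field_simp
        have h2 : (1 + L) * ‖cauchyData u 1‖ ≤ 1 / 2 := by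
          rw [← e]
          gcongr
          exact (not_le.1 h1).le
        have h3 : (2 * (1 + L))⁻¹ ≤ 1 / 2 := by
          rw [← one_div]
          have : 0 ≤ L := by positivity
          gcongr
          linarith
        linarith
      cases Λ with
      | halfLine =>
        exfalso
        have : u 0 = 0 := halfLineTransform_of_notMem (by simp [LatticeKind.sites]) z
        rw [this, norm_zero] at h0
        have : 0 < (2 * (1 + L))⁻¹ := by positivity
        linarith
      | wholeLine =>
        refine quarter_mul_le_two_mul_sum_outerSites_of_left (f := fun k => ‖u k‖ ^ 2) hN hf hη0
          fun k hk hkN => ?_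
        -- Going from `k` up to the data at `0`, that is `(u 1, u 0)`, uses the equation only at
        -- sites `j` with `k < j ≤ 0`, again avoiding the source.
        have hkJ : k + ((-k).toNat : ℤ) = 0 := by omega
        have hJ : (((-k).toNat : ℕ) : ℝ) ≤ N := by
          have : (((-k).toNat : ℕ) : ℤ) = -k := by omega
          have : (((-k).toNat : ℕ) : ℝ) = -(k : ℝ) := by
            exact_mod_cast congrArg (Int.cast : ℤ → ℝ) this
          linarith
        have habs : ∀ j : ℤ, k ≤ j → j ≤ 0 → |(j : ℝ)| ≤ N := fun j hj hjk => by
          have h3 : (k : ℝ) ≤ j := by exact_mod_cast hj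
          have h4 : (j : ℝ) ≤ 0 := by exact_mod_cast hjk
          rw [abs_of_nonpos h4]
          linarith
        have h2 := norm_cauchyData_le_of_left (V := V) (u := u) (z := z) (w := E') (m := k)
          (J := (-k).toNat) (D := C * N ^ α) (δ := 2 / T) (by positivity)
          (fun j hj hjk => hrec j (mem_univ j) (by omega))
          (fun i j hi hik hj hjk => hbound i (mem_univ i) j (mem_univ j)
            (habs i hi (by omega)) (habs j hj (by omega))) hzE
        rw [hkJ] at h2
        rw [← norm_sq_cauchyData]
        exact lowerConstant_sq_mul_le hK hC hN0 hT hJ (norm_nonneg _)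
          (h0.trans (norm_le_cauchyData u 0)) h2
  have e : N ^ (1 - 2 * α) = N * N ^ (-2 * α) := by
    rw [show 1 - 2 * α = 1 + -2 * α by ring, Real.rpow_add hN0, Real.rpow_one]
  rw [e]
  rw [hη] at main
  linarith

theorem scale_rpow {α T : ℝ} (hα : 0 < α) (hT : 0 ≤ T) : scale α T ^ (1 + α) = T := by
  rw [scale, ← Real.rpow_mul hT, one_div_mul_cancel (by positivity), Real.rpow_one]

theorem tendsto_scale {α : ℝ} (hα : 0 < α) : Tendsto (scale α) atTop atTop :=
  tendsto_rpow_atTop (by positivity)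

theorem eventually_le_sum_timeAverage {K C α : ℝ} (hK : 0 < K) (hC : 0 < C) (hα : 0 < α)
    {A : ℝ → Set ℝ} (hA : PowerLawBound Λ V K C α A) : ∀ᶠ T : ℝ in atTop,
      ENNReal.ofReal (lowerConstant V K C ^ 2 / (16 * Real.pi) / T)
          * volume (energyNeighbourhood α A T) * ENNReal.ofReal (scale α T ^ (1 - 2 * α))
        ≤ ∑ n ∈ outerSites Λ (scale α T), ENNReal.ofReal (timeAverage Λ V n T) := by
  filter_upwards [(tendsto_scale hα).eventually hA, (tendsto_scale hα).eventually_ge_atTop 8,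
    eventually_ge_atTop 1] with T hAT hN hT1
  have hT0 : 0 < T := by linarith
  set N := scale α T with hNdef
  have h := ofReal_mul_volume_le_sum_timeAverage (Λ := Λ) (V := V) hT0 (outerSites Λ N)
    (B := energyNeighbourhood α A T) (c := lowerConstant V K C ^ 2 / 8 * N ^ (1 - 2 * α)) (by
      rintro E ⟨E', hE', hEE'⟩
      exact le_sum_norm_sq_halfLineTransform hK hC hN hT1 (scale_rpow hα hT0.le)
        (hAT.2.2.1 hE') (hAT.2.2.2 E' hE') hEE')
  have hpos : 0 < 2 * Real.pi * T := by positivity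
  -- The constant `16π` is the `8` of the pointwise bound times the `2π` of Plancherel's identity.
  have e : ENNReal.ofReal (lowerConstant V K C ^ 2 / (16 * Real.pi) / T)
        * ENNReal.ofReal (N ^ (1 - 2 * α))
      = ENNReal.ofReal (2 * Real.pi * T)⁻¹
        * ENNReal.ofReal (lowerConstant V K C ^ 2 / 8 * N ^ (1 - 2 * α)) := by
    rw [← ENNReal.ofReal_mul (by positivity), ← ENNReal.ofReal_mul (by positivity)]
    congr 1
    field_simp
    ring
  rw [mul_right_comm, e, mul_assoc]
  refine (mul_le_mul_right h _).trans_eq ?_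
  rw [← mul_assoc, ← ENNReal.ofReal_mul (by positivity), inv_mul_cancel₀ hpos.ne',
    ENNReal.ofReal_one, one_mul]

theorem sum_timeAverage_le_outsideProbability (Λ : LatticeKind) (V : ℤ → ℝ) (N T : ℝ) :
    ∑ n ∈ outerSites Λ N, ENNReal.ofReal (timeAverage Λ V n T)
      ≤ outsideProbability Λ V (N / 2) T := by
  refine le_of_le_of_eq ?_ (tsum_subtype {n : Λ.sites | N / 2 ≤ |((n : ℤ) : ℝ)|}
    fun n => ENNReal.ofReal (timeAverage Λ V n T)).symm
  refine le_trans (le_of_eq (Finset.sum_congr rfl fun n hn => ?_)) (ENNReal.sum_le_tsum _)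
  rw [indicator_of_mem]
  exact half_le_of_mem_outerSites hn

theorem mul_sum_timeAverage_le_moment (Λ : LatticeKind) (V : ℤ → ℝ) {p N : ℝ} (hp : 0 < p)
    (hN : 0 ≤ N) (T : ℝ) :
    ENNReal.ofReal ((N / 2) ^ p) * ∑ n ∈ outerSites Λ N, ENNReal.ofReal (timeAverage Λ V n T)
      ≤ moment Λ V p T := by
  rw [Finset.mul_sum]
  refine (Finset.sum_le_sum fun n hn => ?_).trans (ENNReal.sum_le_tsum (outerSites Λ N))
  rw [ENNReal.ofReal_mul (by positivity)]
  gcongr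
  exact half_le_of_mem_outerSites hn

end LowerBounds

end DiscreteSchrodinger

theorem theorem1 (Λ : LatticeKind) (V : ℤ → ℝ) (K C α : ℝ) (hK : 0 < K) (hC : 0 < C) (hα : 0 < α) :
    (∃ c : ℝ, 0 < c ∧ ∀ A : ℝ → Set ℝ, PowerLawBound Λ V K C α A → ∀ᶠ T : ℝ in atTop,
      ENNReal.ofReal (c / T) * volume (energyNeighbourhood α A T) *
          ENNReal.ofReal (scale α T ^ (1 - 2 * α)) ≤
        outsideProbability Λ V (scale α T / 2) T) ∧
    ∀ p : ℝ, 0 < p → ∃ c : ℝ, 0 < c ∧ ∀ A : ℝ → Set ℝ, PowerLawBound Λ V K C α A →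
      ∀ᶠ T : ℝ in atTop,
        ENNReal.ofReal (c / T) * volume (energyNeighbourhood α A T) *
            ENNReal.ofReal (scale α T ^ (p + 1 - 2 * α)) ≤
          moment Λ V p T := by
  have hq := lowerConstant_pos V hK hC
  -- The constants are fixed before `A` is given. The factor `(1/2)^p` comes from the weight `|n|^p
  -- ≥ (N/2)^p` on the outer sites.
  refine ⟨⟨lowerConstant V K C ^ 2 / (16 * Real.pi), by positivity, fun A hA => ?_⟩,
    fun p hp => ⟨(1 / 2) ^ p * (lowerConstant V K C ^ 2 / (16 * Real.pi)), by positivity,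
      fun A hA => ?_⟩⟩
  · filter_upwards [eventually_le_sum_timeAverage hK hC hα hA] with T hT
    exact hT.trans (sum_timeAverage_le_outsideProbability Λ V _ T)
  · filter_upwards [eventually_le_sum_timeAverage hK hC hα hA, eventually_gt_atTop 0]
      with T hT hT0
    have hN : 0 < scale α T := Real.rpow_pos_of_pos hT0 _
    refine le_trans (le_of_eq ?_)
      ((mul_le_mul_right hT _).trans (mul_sum_timeAverage_le_moment Λ V hp hN.le T))
    have e : ENNReal.ofReal ((1 / 2) ^ p * (lowerConstant V K C ^ 2 / (16 * Real.pi)) / T)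
          * ENNReal.ofReal (scale α T ^ (p + 1 - 2 * α))
        = ENNReal.ofReal ((scale α T / 2) ^ p)
          * ENNReal.ofReal (lowerConstant V K C ^ 2 / (16 * Real.pi) / T)
          * ENNReal.ofReal (scale α T ^ (1 - 2 * α)) := by
      rw [← ENNReal.ofReal_mul (by positivity), ← ENNReal.ofReal_mul (by positivity),
        ← ENNReal.ofReal_mul (by positivity), show p + 1 - 2 * α = p + (1 - 2 * α) by ring,
        Real.rpow_add hN, div_eq_mul_one_div (scale α T) 2, Real.mul_rpow hN.le (by norm_num)]
      congr 1
      ring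
    rw [mul_right_comm, e]
    ring
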